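/- Let $\mathbb k$ be a field, $\ell\ge 1$ and $k\ge 0$ integers. A \emph{Stendhal diagram} with $\ell$ red and $k$ black strands is a collection of $\ell$ red and $k$ black smooth curves in $\mathbb R\times[0,1]$, oriented downward at every point (no local extrema), joining the top and bottom lines, without tangencies or triple points, in which red curves do not intersect each other; black curves may carry dots away from crossings. Diagrams are taken up to isotopy preserving these conditions. The product $ab$ is $a$ stacked on top of $b$, and is $0$ if the colours do not match. Number the positions in a horizontal slice $1,2,\dots$ from left to right, and write $x_p$ for a crossing of the strands in positions $p,p+1$, $y_p$ for a dot on the strand in position $p$, and $e_s$ for the diagram of vertical strands with colour sequence $s$; a word of these times $e_s$ is the diagram with bottom $s$. Let $T^\ell_{\ell-2k}$ be the $\mathbb k$-algebra spanned by these diagrams modulo the following local relations, where the colours of the strands involved, at the bottom, are indicated in parentheses (b = black, r = red) and $e$ stands for $e_s$: 1. (bb): $y_px_pe=x_py_{p+1}e-e$, $\;x_py_pe=y_{p+1}x_pe-e$, $\;x_p^2e=0$; 2. (bbb), (bbr), (rbb): $x_px_{p+1}x_pe=x_{p+1}x_px_{p+1}e$; (brb): $x_px_{p+1}x_pe=x_{p+1}x_px_{p+1}e-e$;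 3. (br): $x_py_pe=y_{p+1}x_pe$ and $x_p^2e=y_pe$; (rb): $x_py_{p+1}e=y_px_pe$ and $x_p^2e=y_{p+1}e$; 4. any diagram with a generic horizontal slice whose leftmost strand is black is $0$. Let $R^\ell_k$ be the cyclotomic nilHecke algebra on $k$ strands: the $\mathbb k$-algebra spanned by diagrams of $k$ black strands and no red ones (up to the same isotopies), modulo the relations (bb) of 1, the relation (bbb) of 2, and $y_1^\ell=0$ if $k\geq 1$. Let $e_0\in T^\ell_{\ell-2k}$ be the idempotent given by vertical strands with all red strands to the left of all black strands. \textbf{Theorem.} Placing a nilHecke diagram to the right of $\ell$ vertical red strands defines a homomorphism of (non-unital) $\mathbb k$-algebras $R^\ell_k\to T^\ell_{\ell-2k}$, and this map induces an isomorphism of unital $\mathbb k$-algebras $R^\ell_k\cong e_0T^\ell_{\ell-2k}e_0$. (Here $R^\ell=\bigoplus_k R^\ell_k$ and $T^\ell=\bigoplus_kT^\ell_{\ell-2k}$.) -/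

import Mathlib

namespace Stendhal

/-- The two colours of strands. -/
inductive Strand : Type
  | red : Strand
  | black : Strand
  deriving DecidableEq

instance : Fintype Strand :=
  ⟨{.red, .black}, by rintro (_ | _) <;> simp⟩

/-- The elementary pieces of a diagram with `N` strands, positions being numbered
`0, …, N - 1` from left to right: a dot on the strand in position `p`, or a crossing of the
strands in positions `p` and `p + 1`.  A list `[a₁, …, aₘ]` of such events describes the
diagram, up to isotopy, in which the events occur at different heights, `a₁` at the top and
`aₘ` at the bottom. -/
inductive Event (N : ℕ) : Type
  | dot (p : ℕ) (hp : p < N) : Event N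
  | cross (p : ℕ) (hp : p + 1 < N) : Event N

/-- The same event after `ℓ` further strands have been put to the left. -/
def Event.right (ℓ : ℕ) {k : ℕ} : Event k → Event (ℓ + k)
  | .dot p hp => .dot (ℓ + p) (by omega)
  | .cross p hp => .cross (ℓ + p) (by omega)

/-! ### The cyclotomic nilHecke algebra -/

/-- The relations of the cyclotomic nilHecke algebra on `k` (black) strands, with the
cyclotomic relation of degree `ℓ`.  Products are stacked with the left factor on top. -/
inductive NilHeckeRel (𝕜 : Type*) [Field 𝕜] (ℓ k : ℕ) :
    FreeAlgebra 𝕜 (Event k) → FreeAlgebra 𝕜 (Event k) → Prop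
  -- isotopies: events on disjoint sets of strands can be interchanged
  | dot_dot (p q : ℕ) (hp : p < k) (hq : q < k) :
      NilHeckeRel 𝕜 ℓ k
        (FreeAlgebra.ι 𝕜 (.dot p hp) * FreeAlgebra.ι 𝕜 (.dot q hq))
        (FreeAlgebra.ι 𝕜 (.dot q hq) * FreeAlgebra.ι 𝕜 (.dot p hp))
  | dot_cross (p q : ℕ) (hp : p + 1 < k) (hq : q < k) (h₁ : q ≠ p) (h₂ : q ≠ p + 1) :
      NilHeckeRel 𝕜 ℓ k
        (FreeAlgebra.ι 𝕜 (.dot q hq) * FreeAlgebra.ι 𝕜 (.cross p hp))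
        (FreeAlgebra.ι 𝕜 (.cross p hp) * FreeAlgebra.ι 𝕜 (.dot q hq))
  | cross_cross (p q : ℕ) (hp : p + 1 < k) (hq : q + 1 < k) (h : p + 1 < q) :
      NilHeckeRel 𝕜 ℓ k
        (FreeAlgebra.ι 𝕜 (.cross p hp) * FreeAlgebra.ι 𝕜 (.cross q hq))
        (FreeAlgebra.ι 𝕜 (.cross q hq) * FreeAlgebra.ι 𝕜 (.cross p hp))
  -- dots sliding through a crossing
  | slide_top (p : ℕ) (hp : p + 1 < k) :
      NilHeckeRel 𝕜 ℓ k
        (FreeAlgebra.ι 𝕜 (.dot p (by omega)) * FreeAlgebra.ι 𝕜 (.cross p hp))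
        (FreeAlgebra.ι 𝕜 (.cross p hp) * FreeAlgebra.ι 𝕜 (.dot (p + 1) hp) - 1)
  | slide_bot (p : ℕ) (hp : p + 1 < k) :
      NilHeckeRel 𝕜 ℓ k
        (FreeAlgebra.ι 𝕜 (.cross p hp) * FreeAlgebra.ι 𝕜 (.dot p (by omega)))
        (FreeAlgebra.ι 𝕜 (.dot (p + 1) hp) * FreeAlgebra.ι 𝕜 (.cross p hp) - 1)
  -- bigons and triangles
  | bigon (p : ℕ) (hp : p + 1 < k) :
      NilHeckeRel 𝕜 ℓ k
        (FreeAlgebra.ι 𝕜 (.cross p hp) * FreeAlgebra.ι 𝕜 (.cross p hp))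
        0
  | braid (p : ℕ) (hp : p + 2 < k) :
      NilHeckeRel 𝕜 ℓ k
        (FreeAlgebra.ι 𝕜 (.cross p (by omega)) * FreeAlgebra.ι 𝕜 (.cross (p + 1) hp) *
          FreeAlgebra.ι 𝕜 (.cross p (by omega)))
        (FreeAlgebra.ι 𝕜 (.cross (p + 1) hp) * FreeAlgebra.ι 𝕜 (.cross p (by omega)) *
          FreeAlgebra.ι 𝕜 (.cross (p + 1) hp))
  -- the cyclotomic relation
  | cyclotomic (hk : 0 < k) :
      NilHeckeRel 𝕜 ℓ k (FreeAlgebra.ι 𝕜 (.dot 0 hk) ^ ℓ) 0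

/-- The cyclotomic nilHecke algebra `R^ℓ` on `k` strands. -/
abbrev NilHecke (𝕜 : Type*) [Field 𝕜] (ℓ k : ℕ) : Type _ :=
  RingQuot (NilHeckeRel 𝕜 ℓ k)

/-- The class of a nilHecke diagram in the cyclotomic nilHecke algebra. -/
noncomputable def NilHecke.diagram (𝕜 : Type*) [Field 𝕜] (ℓ k : ℕ) (D : List (Event k)) :
    NilHecke 𝕜 ℓ k :=
  RingQuot.mkAlgHom 𝕜 (NilHeckeRel 𝕜 ℓ k) (D.map (FreeAlgebra.ι 𝕜)).prod

/-! ### The algebra of Stendhal diagrams -/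

/-- The colours met by a generic horizontal slice, from left to right: a sequence of `ℓ` red
and `k` black strands.  It carries the same information as the weakly increasing function `κ`
that counts the black strands to the left of each red strand. -/
abbrev Slice (ℓ k : ℕ) : Type :=
  {s : Fin (ℓ + k) → Strand // (Finset.univ.filter fun p => s p = .red).card = ℓ}

/-- The slice in which the strands are permuted by `f`. -/
def Slice.perm {ℓ k : ℕ} (s : Slice ℓ k) (f : Equiv.Perm (Fin (ℓ + k))) : Slice ℓ k :=
  ⟨fun q => s.1 (f q), Eq.trans
    (Finset.card_bij (fun q _ => f q) (fun q hq => by simpa using hq)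
      (fun a _ b _ h => f.injective h)
      (fun b hb => ⟨f.symm b, by simpa using hb, by simp⟩)) s.2⟩

/-- The slice in which the strands in positions `p` and `p + 1` are exchanged. -/
def Slice.swap {ℓ k : ℕ} (s : Slice ℓ k) (p : ℕ) (hp : p + 1 < ℓ + k) : Slice ℓ k :=
  s.perm (Equiv.swap ⟨p, by omega⟩ ⟨p + 1, hp⟩)

/-- The slice `κ = 0`: all red strands to the left of all black strands. -/
def Slice.zero (ℓ k : ℕ) : Slice ℓ k :=
  ⟨fun p => if (p : ℕ) < ℓ then .red else .black, by
    have h : (Finset.univ.filter fun p : Fin (ℓ + k) =>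
        (if (p : ℕ) < ℓ then Strand.red else Strand.black) = .red) =
        Finset.univ.map (Fin.castAddEmb k : Fin ℓ ↪ Fin (ℓ + k)) := by
      ext p
      simp only [Finset.mem_filter, Finset.mem_univ, true_and, Finset.mem_map]
      constructor
      · intro hp
        have hp' : (p : ℕ) < ℓ := by
          by_contra hc
          simp [hc] at hp
        exact ⟨⟨p, hp'⟩, by ext; simp⟩
      · rintro ⟨q, rfl⟩
        simp
    rw [h, Finset.card_map, Finset.card_univ, Fintype.card_fin]⟩

/-- Generators of the algebra of Stendhal diagrams: the straight-line diagram `e_s` of a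
slice `s`, and the elementary events.  An event stands for the sum over all slices of the
diagrams in which it is the only event, where the impossible ones (a dot on a red strand, a
crossing of two red strands) count as zero. -/
inductive Gen (ℓ k : ℕ) : Type
  | idem (s : Slice ℓ k) : Gen ℓ k
  | event (a : Event (ℓ + k)) : Gen ℓ k

section

variable (𝕜 : Type*) [Field 𝕜] {ℓ k : ℕ}

/-- Vertical strands coloured by `s`. -/
noncomputable def e (s : Slice ℓ k) : FreeAlgebra 𝕜 (Gen ℓ k) :=
  FreeAlgebra.ι 𝕜 (.idem s)

/-- A dot in position `p`. -/
noncomputable def y (p : ℕ) (hp : p < ℓ + k) : FreeAlgebra 𝕜 (Gen ℓ k) :=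
  FreeAlgebra.ι 𝕜 (.event (.dot p hp))

/-- A crossing in positions `p`, `p + 1`. -/
noncomputable def x (p : ℕ) (hp : p + 1 < ℓ + k) : FreeAlgebra 𝕜 (Gen ℓ k) :=
  FreeAlgebra.ι 𝕜 (.event (.cross p hp))

end

/-- The relations between Stendhal diagrams with `ℓ` red and `k` black strands.  Products are
stacked with the left factor on top; a word of events multiplied on the right by `e s` is the
diagram with these events and with bottom slice `s`. -/
inductive StendhalRel (𝕜 : Type*) [Field 𝕜] (ℓ k : ℕ) :
    FreeAlgebra 𝕜 (Gen ℓ k) → FreeAlgebra 𝕜 (Gen ℓ k) → Prop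
  -- stacking of diagrams: zero if the colours do not match
  | idem_idem (s : Slice ℓ k) : StendhalRel 𝕜 ℓ k (e 𝕜 s * e 𝕜 s) (e 𝕜 s)
  | idem_ne (s t : Slice ℓ k) (h : s ≠ t) : StendhalRel 𝕜 ℓ k (e 𝕜 s * e 𝕜 t) 0
  | idem_sum : StendhalRel 𝕜 ℓ k (∑ s : Slice ℓ k, e 𝕜 s) 1
  | dot_idem (s : Slice ℓ k) (p : ℕ) (hp : p < ℓ + k) :
      StendhalRel 𝕜 ℓ k (y 𝕜 p hp * e 𝕜 s) (e 𝕜 s * y 𝕜 p hp)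
  | cross_idem (s : Slice ℓ k) (p : ℕ) (hp : p + 1 < ℓ + k) :
      StendhalRel 𝕜 ℓ k (x 𝕜 p hp * e 𝕜 s) (e 𝕜 (s.swap p hp) * x 𝕜 p hp)
  -- red strands carry no dots and do not cross each other
  | dot_red (s : Slice ℓ k) (p : ℕ) (hp : p < ℓ + k) (h : s.1 ⟨p, hp⟩ = .red) :
      StendhalRel 𝕜 ℓ k (y 𝕜 p hp * e 𝕜 s) 0
  | cross_red (s : Slice ℓ k) (p : ℕ) (hp : p + 1 < ℓ + k)
      (h₁ : s.1 ⟨p, by omega⟩ = .red) (h₂ : s.1 ⟨p + 1, hp⟩ = .red) :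
      StendhalRel 𝕜 ℓ k (x 𝕜 p hp * e 𝕜 s) 0
  -- isotopies: events on disjoint sets of strands can be interchanged
  | dot_dot (p q : ℕ) (hp : p < ℓ + k) (hq : q < ℓ + k) :
      StendhalRel 𝕜 ℓ k (y 𝕜 p hp * y 𝕜 q hq) (y 𝕜 q hq * y 𝕜 p hp)
  | dot_cross (p q : ℕ) (hp : p + 1 < ℓ + k) (hq : q < ℓ + k) (h₁ : q ≠ p) (h₂ : q ≠ p + 1) :
      StendhalRel 𝕜 ℓ k (y 𝕜 q hq * x 𝕜 p hp) (x 𝕜 p hp * y 𝕜 q hq)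
  | cross_cross (p q : ℕ) (hp : p + 1 < ℓ + k) (hq : q + 1 < ℓ + k) (h : p + 1 < q) :
      StendhalRel 𝕜 ℓ k (x 𝕜 p hp * x 𝕜 q hq) (x 𝕜 q hq * x 𝕜 p hp)
  -- dots sliding through a black crossing
  | slide_top (s : Slice ℓ k) (p : ℕ) (hp : p + 1 < ℓ + k)
      (h₁ : s.1 ⟨p, by omega⟩ = .black) (h₂ : s.1 ⟨p + 1, hp⟩ = .black) :
      StendhalRel 𝕜 ℓ k
        (y 𝕜 p (by omega) * x 𝕜 p hp * e 𝕜 s)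
        (x 𝕜 p hp * y 𝕜 (p + 1) hp * e 𝕜 s - e 𝕜 s)
  | slide_bot (s : Slice ℓ k) (p : ℕ) (hp : p + 1 < ℓ + k)
      (h₁ : s.1 ⟨p, by omega⟩ = .black) (h₂ : s.1 ⟨p + 1, hp⟩ = .black) :
      StendhalRel 𝕜 ℓ k
        (x 𝕜 p hp * y 𝕜 p (by omega) * e 𝕜 s)
        (y 𝕜 (p + 1) hp * x 𝕜 p hp * e 𝕜 s - e 𝕜 s)
  -- black bigons and triangles
  | bigon (s : Slice ℓ k) (p : ℕ) (hp : p + 1 < ℓ + k)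
      (h₁ : s.1 ⟨p, by omega⟩ = .black) (h₂ : s.1 ⟨p + 1, hp⟩ = .black) :
      StendhalRel 𝕜 ℓ k (x 𝕜 p hp * x 𝕜 p hp * e 𝕜 s) 0
  | braid (s : Slice ℓ k) (p : ℕ) (hp : p + 2 < ℓ + k)
      (h₁ : s.1 ⟨p, by omega⟩ = .black) (h₂ : s.1 ⟨p + 1, by omega⟩ = .black)
      (h₃ : s.1 ⟨p + 2, hp⟩ = .black) :
      StendhalRel 𝕜 ℓ k
        (x 𝕜 p (by omega) * x 𝕜 (p + 1) hp * x 𝕜 p (by omega) * e 𝕜 s)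
        (x 𝕜 (p + 1) hp * x 𝕜 p (by omega) * x 𝕜 (p + 1) hp * e 𝕜 s)
  -- a black crossing passing from the right to the left of a red strand
  | braid_black_red_black (s : Slice ℓ k) (p : ℕ) (hp : p + 2 < ℓ + k)
      (h₁ : s.1 ⟨p, by omega⟩ = .black) (h₂ : s.1 ⟨p + 1, by omega⟩ = .red)
      (h₃ : s.1 ⟨p + 2, hp⟩ = .black) :
      StendhalRel 𝕜 ℓ k
        (x 𝕜 p (by omega) * x 𝕜 (p + 1) hp * x 𝕜 p (by omega) * e 𝕜 s)
        (x 𝕜 (p + 1) hp * x 𝕜 p (by omega) * x 𝕜 (p + 1) hp * e 𝕜 s - e 𝕜 s)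
  -- a black crossing passing through a red strand that crosses both strands, and its mirror image
  | braid_black_black_red (s : Slice ℓ k) (p : ℕ) (hp : p + 2 < ℓ + k)
      (h₁ : s.1 ⟨p, by omega⟩ = .black) (h₂ : s.1 ⟨p + 1, by omega⟩ = .black)
      (h₃ : s.1 ⟨p + 2, hp⟩ = .red) :
      StendhalRel 𝕜 ℓ k
        (x 𝕜 p (by omega) * x 𝕜 (p + 1) hp * x 𝕜 p (by omega) * e 𝕜 s)
        (x 𝕜 (p + 1) hp * x 𝕜 p (by omega) * x 𝕜 (p + 1) hp * e 𝕜 s)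
  | braid_red_black_black (s : Slice ℓ k) (p : ℕ) (hp : p + 2 < ℓ + k)
      (h₁ : s.1 ⟨p, by omega⟩ = .red) (h₂ : s.1 ⟨p + 1, by omega⟩ = .black)
      (h₃ : s.1 ⟨p + 2, hp⟩ = .black) :
      StendhalRel 𝕜 ℓ k
        (x 𝕜 p (by omega) * x 𝕜 (p + 1) hp * x 𝕜 p (by omega) * e 𝕜 s)
        (x 𝕜 (p + 1) hp * x 𝕜 p (by omega) * x 𝕜 (p + 1) hp * e 𝕜 s)
  -- a dot sliding through a red strand, and the mirror image
  | slide_black_red (s : Slice ℓ k) (p : ℕ) (hp : p + 1 < ℓ + k)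
      (h₁ : s.1 ⟨p, by omega⟩ = .black) (h₂ : s.1 ⟨p + 1, hp⟩ = .red) :
      StendhalRel 𝕜 ℓ k
        (x 𝕜 p hp * y 𝕜 p (by omega) * e 𝕜 s)
        (y 𝕜 (p + 1) hp * x 𝕜 p hp * e 𝕜 s)
  | slide_red_black (s : Slice ℓ k) (p : ℕ) (hp : p + 1 < ℓ + k)
      (h₁ : s.1 ⟨p, by omega⟩ = .red) (h₂ : s.1 ⟨p + 1, hp⟩ = .black) :
      StendhalRel 𝕜 ℓ k
        (x 𝕜 p hp * y 𝕜 (p + 1) hp * e 𝕜 s)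
        (y 𝕜 p (by omega) * x 𝕜 p hp * e 𝕜 s)
  -- red-black bigons
  | bigon_black_red (s : Slice ℓ k) (p : ℕ) (hp : p + 1 < ℓ + k)
      (h₁ : s.1 ⟨p, by omega⟩ = .black) (h₂ : s.1 ⟨p + 1, hp⟩ = .red) :
      StendhalRel 𝕜 ℓ k (x 𝕜 p hp * x 𝕜 p hp * e 𝕜 s) (y 𝕜 p (by omega) * e 𝕜 s)
  | bigon_red_black (s : Slice ℓ k) (p : ℕ) (hp : p + 1 < ℓ + k)
      (h₁ : s.1 ⟨p, by omega⟩ = .red) (h₂ : s.1 ⟨p + 1, hp⟩ = .black) :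
      StendhalRel 𝕜 ℓ k (x 𝕜 p hp * x 𝕜 p hp * e 𝕜 s) (y 𝕜 (p + 1) hp * e 𝕜 s)
  -- a diagram with a slice whose leftmost strand is black is zero
  | violating (s : Slice ℓ k) (h0 : 0 < ℓ + k) (h : s.1 ⟨0, h0⟩ = .black) :
      StendhalRel 𝕜 ℓ k (e 𝕜 s) 0

/-- The algebra of Stendhal diagrams with `ℓ` red and `k` black strands, denoted
`T^ℓ_n` with `n = ℓ - 2k`. -/
abbrev TAlg (𝕜 : Type*) [Field 𝕜] (ℓ k : ℕ) : Type _ :=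
  RingQuot (StendhalRel 𝕜 ℓ k)

/-- The class of the diagram with events `D` (from top to bottom) and bottom slice `s`. -/
noncomputable def TAlg.diagram (𝕜 : Type*) [Field 𝕜] {ℓ k : ℕ} (D : List (Event (ℓ + k)))
    (s : Slice ℓ k) : TAlg 𝕜 ℓ k :=
  RingQuot.mkAlgHom 𝕜 (StendhalRel 𝕜 ℓ k)
    ((D.map fun a => FreeAlgebra.ι 𝕜 (Gen.event a)).prod * e 𝕜 s)

/-- The idempotent `e_0`: vertical strands, all red strands to the left of all black ones. -/
noncomputable def eZero (𝕜 : Type*) [Field 𝕜] (ℓ k : ℕ) : TAlg 𝕜 ℓ k :=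
  TAlg.diagram 𝕜 [] (Slice.zero ℓ k)

theorem isIdempotentElem_eZero (𝕜 : Type*) [Field 𝕜] (ℓ k : ℕ) :
    IsIdempotentElem (eZero 𝕜 ℓ k) := by
  have h := RingQuot.mkAlgHom_rel 𝕜 (StendhalRel.idem_idem (𝕜 := 𝕜) (Slice.zero ℓ k))
  rw [map_mul] at h
  simpa [IsIdempotentElem, eZero, TAlg.diagram] using h

/-- The corner ring `e A e` of an algebra is an algebra. -/
noncomputable instance cornerAlgebra {𝕜 A : Type*} [CommSemiring 𝕜] [Semiring A] [Algebra 𝕜 A]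
    {e : A} (he : IsIdempotentElem e) : Algebra 𝕜 he.Corner where
  smul c a := ⟨c • a.1, by
    obtain ⟨r, hr⟩ := a.2
    exact ⟨c • r, by rw [← hr]; simp⟩⟩
  algebraMap :=
    { toFun := fun c => ⟨c • e, c • e, by simp [he.eq]⟩
      map_one' := Subtype.ext (one_smul 𝕜 e)
      map_mul' := fun a b => Subtype.ext (by
        change (a * b) • e = (a • e) * (b • e)
        rw [smul_mul_smul_comm, he.eq])
      map_zero' := Subtype.ext (zero_smul 𝕜 e)
      map_add' := fun a b => Subtype.ext (add_smul a b e) }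
  commutes' c a := Subtype.ext (by
    change (c • e) * a.1 = a.1 * (c • e)
    have h := (Subsemigroup.mem_corner_iff he).mp a.2
    rw [smul_mul_assoc, mul_smul_comm, h.1, h.2])
  smul_def' c a := Subtype.ext (by
    change c • a.1 = (c • e) * a.1
    rw [smul_mul_assoc, ((Subsemigroup.mem_corner_iff he).mp a.2).1])

end Stendhal

/-! Write R and T for the two algebras. To the right of the red strands, the nilHecke relations are
relations of T, except that y_1^ℓ = 0 needs an argument. By the red-black bigon, a dot equals a
double crossing with the red strand on its left. Spending one dot per red strand pulls the first
black strand to the far left, where the diagram vanishes (`TAlg.dot_pow_mul_E_eq_zero`). This gives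
`cornerHom` from R to e_0 T e_0.

Surjectivity: each slice s is the top of exactly one straight diagram starting at `Slice.zero`
(`exists_straight`, `Straight.unique`). Dots and black crossings on top of a straight diagram move
to its bottom without correction terms, since the only triangle needed is (rbb). A crossing of a red
and a black strand either lengthens the diagram or closes a bigon, that is, produces a dot. So the
products of straight and nilHecke diagrams span a left ideal containing T e_0
(`mul_mem_straightSpan`). Multiplying by e_0 on the left leaves only nilHecke diagrams.

Injectivity: let T act on families (f_s) of elements of R indexed by slices. Black strands act as in
R, and a red-black crossing acts by 1 or by a dot, according to its direction. These operators
satisfy all relations except the vanishing of e_s when s starts with a black strand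
(`lift_genOp_rel`). This is repaired by restricting f_s to the right ideal m_s R, where the monomial
m_s (`sliceMonomial`) has one dot for each pair of a black strand and a red strand on its right. The
restriction is stable. If s starts with black, then y_1^ℓ divides m_s and the component is zero. At
`Slice.zero` the monomial is 1, so the component is all of R. There the image of `cornerHom` acts by
left multiplication, and evaluation at 1 recovers the element. -/

namespace Stendhal

/-! ### Colours of slices -/

section Slices

variable {ℓ k : ℕ}

/-- The colour in position `p`, with the value `black` outside of the range of positions. -/
def Slice.col (s : Slice ℓ k) (p : ℕ) : Strand :=
  if h : p < ℓ + k then s.1 ⟨p, h⟩ else .black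

theorem Slice.col_eq (s : Slice ℓ k) {p : ℕ} (hp : p < ℓ + k) : s.col p = s.1 ⟨p, hp⟩ :=
  dif_pos hp

theorem Slice.ext_col {s t : Slice ℓ k} (h : ∀ p < ℓ + k, s.col p = t.col p) : s = t := by
  apply Subtype.ext
  funext ⟨p, hp⟩
  simpa [Slice.col_eq _ hp] using h p hp

/-- The purpose of the default value `black`: a red position is automatically in range. -/
theorem Slice.lt_of_col_red {s : Slice ℓ k} {p : ℕ} (h : s.col p = .red) : p < ℓ + k := by
  by_contra hc
  simp [Slice.col, hc] at h

theorem Strand.ne_red {c : Strand} : c ≠ .red ↔ c = .black := by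
  cases c <;> simp

theorem Strand.ne_black {c : Strand} : c ≠ .black ↔ c = .red := by
  cases c <;> simp

theorem Slice.col_swap (s : Slice ℓ k) (p : ℕ) (hp : p + 1 < ℓ + k) (q : ℕ) :
    (s.swap p hp).col q =
      if q = p then s.col (p + 1) else if q = p + 1 then s.col p else s.col q := by
  by_cases hq : q < ℓ + k
  · rw [Slice.col_eq _ hq, Slice.col_eq _ hp, Slice.col_eq _ (show p < ℓ + k by omega),
      Slice.col_eq _ hq]
    simp only [Slice.swap, Slice.perm, Equiv.swap_apply_def, Fin.mk.injEq]
    split_ifs <;> rfl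
  · have h₁ : q ≠ p := by omega
    have h₂ : q ≠ p + 1 := by omega
    simp [Slice.col, hq, h₁, h₂]

theorem Slice.col_swap_left (s : Slice ℓ k) (p : ℕ) (hp : p + 1 < ℓ + k) :
    (s.swap p hp).col p = s.col (p + 1) := by
  simp [Slice.col_swap]

theorem Slice.col_swap_right (s : Slice ℓ k) (p : ℕ) (hp : p + 1 < ℓ + k) :
    (s.swap p hp).col (p + 1) = s.col p := by
  simp [Slice.col_swap]

theorem Slice.col_swap_of_ne (s : Slice ℓ k) {p q : ℕ} (hp : p + 1 < ℓ + k) (h₁ : q ≠ p)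
    (h₂ : q ≠ p + 1) : (s.swap p hp).col q = s.col q := by
  simp [Slice.col_swap, h₁, h₂]

theorem Slice.swap_swap (s : Slice ℓ k) (p : ℕ) (hp : p + 1 < ℓ + k) :
    (s.swap p hp).swap p hp = s :=
  Slice.ext_col fun q _ => by simp only [Slice.col_swap]; grind

theorem Slice.swap_comm (s : Slice ℓ k) {p q : ℕ} (hp : p + 1 < ℓ + k) (hq : q + 1 < ℓ + k)
    (h : p + 1 < q) : (s.swap p hp).swap q hq = (s.swap q hq).swap p hp :=
  Slice.ext_col fun r _ => by simp only [Slice.col_swap]; grind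

theorem Slice.swap_eq_self (s : Slice ℓ k) {p : ℕ} (hp : p + 1 < ℓ + k)
    (h : s.col p = s.col (p + 1)) : s.swap p hp = s :=
  Slice.ext_col fun q _ => by simp only [Slice.col_swap]; grind

theorem Slice.col_zero (p : ℕ) :
    (Slice.zero ℓ k).col p = if p < ℓ then .red else .black := by
  by_cases hp : p < ℓ + k
  · rw [Slice.col_eq _ hp]; rfl
  · have : ¬ p < ℓ := by omega
    simp [Slice.col, hp, this]

/-! ### Counting strands -/

/-- The positions of the red strands. -/
def Slice.reds (s : Slice ℓ k) : Finset ℕ :=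
  (Finset.range (ℓ + k)).filter fun q => s.col q = .red

theorem Slice.mem_reds {s : Slice ℓ k} {q : ℕ} : q ∈ s.reds ↔ s.col q = .red := by
  simp only [Slice.reds, Finset.mem_filter, Finset.mem_range, and_iff_right_iff_imp]
  exact Slice.lt_of_col_red

theorem Slice.card_reds (s : Slice ℓ k) : s.reds.card = ℓ := by
  have h : s.reds = (Finset.univ.filter fun p => s.1 p = .red).map Fin.valEmbedding := by
    ext q
    simp only [Slice.mem_reds, Finset.mem_map, Finset.mem_filter, Finset.mem_univ, true_and,
      Fin.valEmbedding_apply]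
    constructor
    · intro hq
      have hlt := Slice.lt_of_col_red hq
      exact ⟨⟨q, hlt⟩, by rwa [Slice.col_eq _ hlt] at hq, rfl⟩
    · rintro ⟨p, hp, rfl⟩
      rwa [Slice.col_eq _ p.2]
  rw [h, Finset.card_map, s.2]

/-- The number of black strands to the left of position `p`. -/
def Slice.nblack (s : Slice ℓ k) (p : ℕ) : ℕ := Nat.count (fun q => s.col q = .black) p

theorem Slice.nblack_succ (s : Slice ℓ k) (p : ℕ) :
    s.nblack (p + 1) = s.nblack p + if s.col p = .black then 1 else 0 :=
  Nat.count_succ _ _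

theorem Slice.nblack_mono (s : Slice ℓ k) {p q : ℕ} (h : p ≤ q) : s.nblack p ≤ s.nblack q :=
  Nat.count_monotone _ h

theorem Slice.nblack_total (s : Slice ℓ k) : s.nblack (ℓ + k) = k := by
  have h := Finset.card_filter_add_card_filter_not (s := Finset.range (ℓ + k))
    (fun q => s.col q = .red)
  have h' := s.card_reds
  simp only [Strand.ne_red] at h
  rw [Slice.reds] at h'
  rw [Slice.nblack, Nat.count_eq_card_filter_range]
  rw [h', Finset.card_range] at h
  omega

theorem Slice.nblack_le (s : Slice ℓ k) {p : ℕ} (hp : p ≤ ℓ + k) : s.nblack p ≤ k :=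
  (s.nblack_mono hp).trans s.nblack_total.le

theorem Slice.nblack_congr {s t : Slice ℓ k} {p : ℕ} (h : ∀ q < p, s.col q = t.col q) :
    s.nblack p = t.nblack p := by
  induction p with
  | zero => simp [Slice.nblack]
  | succ p ih =>
    rw [Slice.nblack_succ, Slice.nblack_succ, ih fun q hq => h q (by omega), h p (by omega)]

theorem Slice.nblack_swap_of_le (s : Slice ℓ k) {p q : ℕ} (hp : p + 1 < ℓ + k) (h : q ≤ p) :
    (s.swap p hp).nblack q = s.nblack q :=
  Slice.nblack_congr fun r hr => s.col_swap_of_ne hp (by omega) (by omega)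

theorem Slice.nblack_swap_of_lt (s : Slice ℓ k) {p q : ℕ} (hp : p + 1 < ℓ + k) (h : p + 1 < q) :
    (s.swap p hp).nblack q = s.nblack q := by
  induction q, h using Nat.le_induction with
  | base =>
    rw [Slice.nblack_succ, Slice.nblack_succ, Slice.nblack_succ, Slice.nblack_succ,
      s.nblack_swap_of_le hp le_rfl, s.col_swap_left, s.col_swap_right]
    omega
  | succ q hq ih =>
    rw [Slice.nblack_succ, Slice.nblack_succ, ih, s.col_swap_of_ne hp (by omega) (by omega)]

theorem Slice.nblack_zero_slice (p : ℕ) : (Slice.zero ℓ k).nblack (ℓ + p) = p := by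
  induction p with
  | zero =>
    rw [Slice.nblack, Nat.count_eq_card_filter_range, Finset.card_eq_zero,
      Finset.filter_eq_empty_iff]
    intro q hq
    have hq : q < ℓ := by simpa using hq
    simp [Slice.col_zero, hq]
  | succ p ih => rw [← add_assoc, Slice.nblack_succ, ih]; simp [Slice.col_zero]

/-! ### Products over the red strands and the disorder of a slice -/

/-- The product of `F (s.nblack q)` over the positions `q` of the red strands. -/
def Slice.redProd {M : Type*} [CommMonoid M] (F : ℕ → M) (s : Slice ℓ k) : M :=
  ∏ q ∈ Finset.range (ℓ + k), if s.col q = .red then F (s.nblack q) else 1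

theorem Slice.redProd_eq {M : Type*} [CommMonoid M] (F : ℕ → M) (s : Slice ℓ k) :
    s.redProd F = ∏ q ∈ s.reds, F (s.nblack q) :=
  (Finset.prod_filter _ _).symm

/-- One red strand moves right past one black strand, so its own factor is the only one that
changes. It is used with powers of 2 for `disorder` and with products of variables for
`sliceMonomial`. -/
theorem Slice.redProd_swap {M : Type*} [CommMonoid M] {F : ℕ → M} {g : M} (s : Slice ℓ k) {p : ℕ}
    (hp : p + 1 < ℓ + k) (h₁ : s.col p = .red) (h₂ : s.col (p + 1) = .black)
    (hF : F (s.nblack p + 1) = g * F (s.nblack p)) :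
    (s.swap p hp).redProd F = g * s.redProd F := by
  -- Beyond position `p + 1` both products acquire the same factors, so the comparison is made at
  -- the cutoff `p + 2` and then extended by induction.
  suffices h : ∀ n, p + 2 ≤ n →
      (∏ q ∈ Finset.range n,
        if (s.swap p hp).col q = .red then F ((s.swap p hp).nblack q) else 1) =
      g * ∏ q ∈ Finset.range n, if s.col q = .red then F (s.nblack q) else 1 from h _ hp
  intro n hn
  induction n, hn using Nat.le_induction with
  | base =>
    have h : ∀ q ∈ Finset.range p,
        (if (s.swap p hp).col q = .red then F ((s.swap p hp).nblack q) else 1) =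
          if s.col q = .red then F (s.nblack q) else 1 := by
      intro q hq
      have hq := Finset.mem_range.mp hq
      rw [s.col_swap_of_ne hp (by omega) (by omega), s.nblack_swap_of_le hp hq.le]
    simp only [Finset.prod_range_succ]
    rw [Finset.prod_congr rfl h, s.col_swap_left, s.col_swap_right, Slice.nblack_succ,
      s.nblack_swap_of_le hp le_rfl, s.col_swap_left]
    simp [h₁, h₂, hF, mul_left_comm]
  | succ q hq ih =>
    rw [Finset.prod_range_succ, Finset.prod_range_succ, ih,
      s.col_swap_of_ne hp (by omega) (by omega), s.nblack_swap_of_lt hp (by omega), mul_assoc]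

/-- A measure of how far the red strands are from being on the left. -/
def Slice.disorder (s : Slice ℓ k) : ℕ := s.redProd fun j => 2 ^ j

/-- Undoing the swap moves a red strand right past a black one and doubles the positive number
`disorder`. This drives the inductions on straight diagrams. -/
theorem Slice.disorder_swap_lt (s : Slice ℓ k) {p : ℕ} (hp : p + 1 < ℓ + k)
    (h₁ : s.col p = .black) (h₂ : s.col (p + 1) = .red) :
    (s.swap p hp).disorder < s.disorder := by
  have h := (s.swap p hp).redProd_swap (F := fun j => 2 ^ j) (g := 2) hp
    (by rwa [s.col_swap_left]) (by rwa [s.col_swap_right]) (by ring)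
  rw [Slice.swap_swap] at h
  have hpos : 0 < (s.swap p hp).redProd fun j => 2 ^ j := by
    rw [Slice.redProd_eq]; exact Finset.prod_pos fun _ _ => by positivity
  unfold Slice.disorder
  omega

/-- If no black strand has a red one directly on its right, everything to the right of a black
strand is black. The slice is then a red block followed by a black one, and having ℓ red strands
fixes the boundary. -/
theorem Slice.exists_black_red (s : Slice ℓ k) (hs : s ≠ Slice.zero ℓ k) :
    ∃ p, ∃ _ : p + 1 < ℓ + k, s.col p = .black ∧ s.col (p + 1) = .red := by
  by_contra! hc
  have hstep : ∀ p, s.col p = .black → s.col (p + 1) = .black := fun p hp => by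
    by_contra h
    have h := Strand.ne_black.mp h
    exact hc p (Slice.lt_of_col_red h) hp h
  have hup : ∀ p q, p ≤ q → s.col p = .black → s.col q = .black := by
    intro p q hpq hp
    induction q, hpq using Nat.le_induction with
    | base => exact hp
    | succ q _ ih => exact hstep q ih
  apply hs
  refine Slice.ext_col fun p hp => ?_
  rw [Slice.col_zero]
  split_ifs with hpl
  · by_contra h
    have h := Strand.ne_red.mp h
    have hsub : s.reds ⊆ Finset.range p := fun q hq => by
      rw [Finset.mem_range]
      by_contra hqp
      rw [Slice.mem_reds, hup p q (by omega) h] at hq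
      cases hq
    have := Finset.card_le_card hsub
    rw [s.card_reds, Finset.card_range] at this
    omega
  · by_contra h
    have h := Strand.ne_black.mp h
    have hsub : Finset.range (p + 1) ⊆ s.reds := fun q hq => by
      rw [Slice.mem_reds]
      by_contra hqr
      rw [hup q p (by simpa [Nat.lt_succ_iff] using hq) (Strand.ne_red.mp hqr)] at h
      cases h
    have := Finset.card_le_card hsub
    rw [s.card_reds, Finset.card_range] at this
    omega

end Slices

/-! ### Relations in the algebra of Stendhal diagrams -/

section Relations

variable (𝕜 : Type*) [Field 𝕜] {ℓ k : ℕ}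

/-- The class of `e s`. -/
noncomputable def TAlg.E (s : Slice ℓ k) : TAlg 𝕜 ℓ k :=
  RingQuot.mkAlgHom 𝕜 (StendhalRel 𝕜 ℓ k) (e 𝕜 s)

/-- The class of a dot. -/
noncomputable def TAlg.Y (p : ℕ) (hp : p < ℓ + k) : TAlg 𝕜 ℓ k :=
  RingQuot.mkAlgHom 𝕜 (StendhalRel 𝕜 ℓ k) (y 𝕜 p hp)

/-- The class of a crossing. -/
noncomputable def TAlg.X (p : ℕ) (hp : p + 1 < ℓ + k) : TAlg 𝕜 ℓ k :=
  RingQuot.mkAlgHom 𝕜 (StendhalRel 𝕜 ℓ k) (x 𝕜 p hp)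

open TAlg

/-- The relations needed for the homomorphism and for spanning, restated with `Slice.col`. The (brb)
and (bbr) triangles and the (br) bigon are not among them; they only enter when the representation
is checked. -/
theorem TAlg.E_mul_E_self (s : Slice ℓ k) : E 𝕜 s * E 𝕜 s = E 𝕜 s := by
  simpa only [E, Y, X, map_mul] using RingQuot.mkAlgHom_rel 𝕜 (StendhalRel.idem_idem (𝕜 := 𝕜) s)

theorem TAlg.E_mul_E_of_ne {s t : Slice ℓ k} (h : s ≠ t) : E 𝕜 s * E 𝕜 t = 0 := by
  simpa only [E, Y, X, map_mul, map_zero] using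
    RingQuot.mkAlgHom_rel 𝕜 (StendhalRel.idem_ne (𝕜 := 𝕜) s t h)

theorem TAlg.Y_mul_E (s : Slice ℓ k) (p : ℕ) (hp : p < ℓ + k) :
    Y 𝕜 p hp * E 𝕜 s = E 𝕜 s * Y 𝕜 p hp := by
  simpa only [E, Y, X, map_mul] using RingQuot.mkAlgHom_rel 𝕜 (StendhalRel.dot_idem (𝕜 := 𝕜) s p hp)

theorem TAlg.X_mul_E (s : Slice ℓ k) (p : ℕ) (hp : p + 1 < ℓ + k) :
    X 𝕜 p hp * E 𝕜 s = E 𝕜 (s.swap p hp) * X 𝕜 p hp := by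
  simpa only [E, Y, X, map_mul] using RingQuot.mkAlgHom_rel 𝕜 (StendhalRel.cross_idem (𝕜 := 𝕜) s p hp)

theorem TAlg.dot_red {s : Slice ℓ k} {p : ℕ} (hp : p < ℓ + k) (h : s.col p = .red) :
    Y 𝕜 p hp * E 𝕜 s = 0 := by
  rw [Slice.col_eq _ hp] at h
  simpa only [E, Y, X, map_mul, map_zero] using
    RingQuot.mkAlgHom_rel 𝕜 (StendhalRel.dot_red (𝕜 := 𝕜) s p hp h)

theorem TAlg.cross_red {s : Slice ℓ k} {p : ℕ} (hp : p + 1 < ℓ + k) (h₁ : s.col p = .red)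
    (h₂ : s.col (p + 1) = .red) : X 𝕜 p hp * E 𝕜 s = 0 := by
  rw [Slice.col_eq _ (by omega)] at h₁ h₂
  simpa only [E, Y, X, map_mul, map_zero] using
    RingQuot.mkAlgHom_rel 𝕜 (StendhalRel.cross_red (𝕜 := 𝕜) s p hp h₁ h₂)

theorem TAlg.dot_dot (p q : ℕ) (hp : p < ℓ + k) (hq : q < ℓ + k) :
    Y 𝕜 p hp * Y 𝕜 q hq = Y 𝕜 q hq * Y 𝕜 p hp := by
  simpa only [E, Y, X, map_mul] using RingQuot.mkAlgHom_rel 𝕜 (StendhalRel.dot_dot (𝕜 := 𝕜) p q hp hq)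

theorem TAlg.dot_cross (p q : ℕ) (hp : p + 1 < ℓ + k) (hq : q < ℓ + k) (h₁ : q ≠ p)
    (h₂ : q ≠ p + 1) : Y 𝕜 q hq * X 𝕜 p hp = X 𝕜 p hp * Y 𝕜 q hq := by
  simpa only [E, Y, X, map_mul] using
    RingQuot.mkAlgHom_rel 𝕜 (StendhalRel.dot_cross (𝕜 := 𝕜) p q hp hq h₁ h₂)

theorem TAlg.cross_cross (p q : ℕ) (hp : p + 1 < ℓ + k) (hq : q + 1 < ℓ + k) (h : p + 1 < q) :
    X 𝕜 p hp * X 𝕜 q hq = X 𝕜 q hq * X 𝕜 p hp := by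
  simpa only [E, Y, X, map_mul] using
    RingQuot.mkAlgHom_rel 𝕜 (StendhalRel.cross_cross (𝕜 := 𝕜) p q hp hq h)

theorem TAlg.slide_top {s : Slice ℓ k} {p : ℕ} (hp : p + 1 < ℓ + k) (h₁ : s.col p = .black)
    (h₂ : s.col (p + 1) = .black) :
    Y 𝕜 p (by omega) * X 𝕜 p hp * E 𝕜 s = X 𝕜 p hp * Y 𝕜 (p + 1) hp * E 𝕜 s - E 𝕜 s := by
  rw [Slice.col_eq _ (by omega)] at h₁ h₂
  simpa only [E, Y, X, map_mul, map_sub] using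
    RingQuot.mkAlgHom_rel 𝕜 (StendhalRel.slide_top (𝕜 := 𝕜) s p hp h₁ h₂)

theorem TAlg.slide_bot {s : Slice ℓ k} {p : ℕ} (hp : p + 1 < ℓ + k) (h₁ : s.col p = .black)
    (h₂ : s.col (p + 1) = .black) :
    X 𝕜 p hp * Y 𝕜 p (by omega) * E 𝕜 s = Y 𝕜 (p + 1) hp * X 𝕜 p hp * E 𝕜 s - E 𝕜 s := by
  rw [Slice.col_eq _ (by omega)] at h₁ h₂
  simpa only [E, Y, X, map_mul, map_sub] using
    RingQuot.mkAlgHom_rel 𝕜 (StendhalRel.slide_bot (𝕜 := 𝕜) s p hp h₁ h₂)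

theorem TAlg.bigon {s : Slice ℓ k} {p : ℕ} (hp : p + 1 < ℓ + k) (h₁ : s.col p = .black)
    (h₂ : s.col (p + 1) = .black) : X 𝕜 p hp * X 𝕜 p hp * E 𝕜 s = 0 := by
  rw [Slice.col_eq _ (by omega)] at h₁ h₂
  simpa only [E, Y, X, map_mul, map_zero] using
    RingQuot.mkAlgHom_rel 𝕜 (StendhalRel.bigon (𝕜 := 𝕜) s p hp h₁ h₂)

theorem TAlg.braid {s : Slice ℓ k} {p : ℕ} (hp : p + 2 < ℓ + k)
    (h₁ : s.col p = .black) (h₂ : s.col (p + 1) = .black) (h₃ : s.col (p + 2) = .black) :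
    X 𝕜 p (by omega) * X 𝕜 (p + 1) hp * X 𝕜 p (by omega) * E 𝕜 s =
      X 𝕜 (p + 1) hp * X 𝕜 p (by omega) * X 𝕜 (p + 1) hp * E 𝕜 s := by
  rw [Slice.col_eq _ (by omega)] at h₁ h₂ h₃
  simpa only [E, Y, X, map_mul] using
    RingQuot.mkAlgHom_rel 𝕜 (StendhalRel.braid (𝕜 := 𝕜) s p hp h₁ h₂ h₃)

theorem TAlg.braid_red_black_black {s : Slice ℓ k} {p : ℕ} (hp : p + 2 < ℓ + k)
    (h₁ : s.col p = .red) (h₂ : s.col (p + 1) = .black) (h₃ : s.col (p + 2) = .black) :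
    X 𝕜 p (by omega) * X 𝕜 (p + 1) hp * X 𝕜 p (by omega) * E 𝕜 s =
      X 𝕜 (p + 1) hp * X 𝕜 p (by omega) * X 𝕜 (p + 1) hp * E 𝕜 s := by
  rw [Slice.col_eq _ (by omega)] at h₁ h₂ h₃
  simpa only [E, Y, X, map_mul] using
    RingQuot.mkAlgHom_rel 𝕜 (StendhalRel.braid_red_black_black (𝕜 := 𝕜) s p hp h₁ h₂ h₃)

theorem TAlg.slide_black_red {s : Slice ℓ k} {p : ℕ} (hp : p + 1 < ℓ + k)
    (h₁ : s.col p = .black) (h₂ : s.col (p + 1) = .red) :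
    X 𝕜 p hp * Y 𝕜 p (by omega) * E 𝕜 s = Y 𝕜 (p + 1) hp * X 𝕜 p hp * E 𝕜 s := by
  rw [Slice.col_eq _ (by omega)] at h₁ h₂
  simpa only [E, Y, X, map_mul] using
    RingQuot.mkAlgHom_rel 𝕜 (StendhalRel.slide_black_red (𝕜 := 𝕜) s p hp h₁ h₂)

theorem TAlg.slide_red_black {s : Slice ℓ k} {p : ℕ} (hp : p + 1 < ℓ + k)
    (h₁ : s.col p = .red) (h₂ : s.col (p + 1) = .black) :
    X 𝕜 p hp * Y 𝕜 (p + 1) hp * E 𝕜 s = Y 𝕜 p (by omega) * X 𝕜 p hp * E 𝕜 s := by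
  rw [Slice.col_eq _ (by omega)] at h₁ h₂
  simpa only [E, Y, X, map_mul] using
    RingQuot.mkAlgHom_rel 𝕜 (StendhalRel.slide_red_black (𝕜 := 𝕜) s p hp h₁ h₂)

theorem TAlg.bigon_red_black {s : Slice ℓ k} {p : ℕ} (hp : p + 1 < ℓ + k)
    (h₁ : s.col p = .red) (h₂ : s.col (p + 1) = .black) :
    X 𝕜 p hp * X 𝕜 p hp * E 𝕜 s = Y 𝕜 (p + 1) hp * E 𝕜 s := by
  rw [Slice.col_eq _ (by omega)] at h₁ h₂
  simpa only [E, Y, X, map_mul] using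
    RingQuot.mkAlgHom_rel 𝕜 (StendhalRel.bigon_red_black (𝕜 := 𝕜) s p hp h₁ h₂)

theorem TAlg.violating {s : Slice ℓ k} (h0 : 0 < ℓ + k) (h : s.col 0 = .black) : E 𝕜 s = 0 := by
  rw [Slice.col_eq _ h0] at h
  simpa only [E, Y, X, map_zero] using
    RingQuot.mkAlgHom_rel 𝕜 (StendhalRel.violating (𝕜 := 𝕜) s h0 h)

/-- A black strand with only red strands on its left can be pulled to the far left at the cost
of a dot for every red strand. -/
theorem TAlg.dot_pow_mul_E_eq_zero {s : Slice ℓ k} {p : ℕ} (hp : p < ℓ + k)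
    (h : s.col p = .black) (h' : ∀ q < p, s.col q = .red) : Y 𝕜 p hp ^ p * E 𝕜 s = 0 := by
  induction p generalizing s with
  | zero => rw [violating 𝕜 hp h, mul_zero]
  | succ p ih =>
    have hr := h' p (by omega)
    have hl : (s.swap p hp).col p = .black := by rw [s.col_swap_left, h]
    have key : ∀ n : ℕ, Y 𝕜 (p + 1) hp ^ n * X 𝕜 p hp * E 𝕜 (s.swap p hp) =
        X 𝕜 p hp * Y 𝕜 p (by omega) ^ n * E 𝕜 (s.swap p hp) := by
      intro n
      induction n with
      | zero => simp
      | succ n ihn =>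
        have hs := slide_black_red 𝕜 hp hl (by rw [s.col_swap_right, hr])
        rw [pow_succ, mul_assoc, mul_assoc, ← mul_assoc (Y 𝕜 (p + 1) hp), ← hs, mul_assoc,
          Y_mul_E, ← mul_assoc, ← mul_assoc, ihn, mul_assoc, ← Y_mul_E, ← mul_assoc,
          mul_assoc (X 𝕜 p hp), ← pow_succ]
    have h0 := ih (s := s.swap p hp) (by omega) hl fun q hq => by
      rw [s.col_swap_of_ne hp (by omega) (by omega)]; exact h' q (by omega)
    -- One of the `p + 1` dots becomes a double crossing with the red strand on the left. The other
    -- `p` dots slide into the bigon, where the black strand is in position `p` and the induction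
    -- hypothesis applies.
    rw [pow_succ, mul_assoc, ← bigon_red_black 𝕜 hp hr h, mul_assoc, X_mul_E, ← mul_assoc,
      ← mul_assoc, key, mul_assoc (X 𝕜 p hp), h0, mul_zero, zero_mul]

end Relations

/-! ### The homomorphism from the cyclotomic nilHecke algebra -/

section CornerHom

variable (𝕜 : Type*) [Field 𝕜] (ℓ k : ℕ)

open TAlg

/-- The class of an event. -/
noncomputable def TAlg.ev {ℓ k : ℕ} (a : Event (ℓ + k)) : TAlg 𝕜 ℓ k :=
  RingQuot.mkAlgHom 𝕜 (StendhalRel 𝕜 ℓ k) (FreeAlgebra.ι 𝕜 (Gen.event a))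

theorem eZero_eq : eZero 𝕜 ℓ k = E 𝕜 (Slice.zero ℓ k) := by
  simp [eZero, TAlg.diagram, E]

/-- The corner `e₀ T e₀`. -/
abbrev ZeroCorner : Type _ := (isIdempotentElem_eZero 𝕜 ℓ k).Corner

/-- Such an event can only exchange two black strands, so it preserves the slice `Slice.zero`. -/
theorem ev_right_mul_eZero (a : Event k) :
    ev 𝕜 (a.right ℓ) * eZero 𝕜 ℓ k = eZero 𝕜 ℓ k * ev 𝕜 (a.right ℓ) := by
  rw [eZero_eq]
  cases a with
  | dot p hp => exact Y_mul_E 𝕜 _ _ _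
  | cross p hp =>
    have h := X_mul_E 𝕜 (Slice.zero ℓ k) (ℓ + p) (by omega)
    rw [Slice.swap_eq_self _ _ (by rw [Slice.col_zero, Slice.col_zero]; simp; omega)] at h
    exact h

/-- An event to the right of the red strands, as an element of the corner. -/
noncomputable def cornerEvent (a : Event k) : ZeroCorner 𝕜 ℓ k :=
  ⟨ev 𝕜 (a.right ℓ) * eZero 𝕜 ℓ k, ev 𝕜 (a.right ℓ), by
    change eZero 𝕜 ℓ k * ev 𝕜 (a.right ℓ) * eZero 𝕜 ℓ k = _
    rw [← ev_right_mul_eZero, mul_assoc, (isIdempotentElem_eZero 𝕜 ℓ k).eq]⟩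

theorem eZero_mul_val (a : ZeroCorner 𝕜 ℓ k) : eZero 𝕜 ℓ k * a.1 = a.1 :=
  ((Subsemigroup.mem_corner_iff (isIdempotentElem_eZero 𝕜 ℓ k)).mp a.2).1

theorem val_mul_eZero (a : ZeroCorner 𝕜 ℓ k) : a.1 * eZero 𝕜 ℓ k = a.1 :=
  ((Subsemigroup.mem_corner_iff (isIdempotentElem_eZero 𝕜 ℓ k)).mp a.2).2

/-- The inner e_0 is absorbed, so relations in the corner become relations in T with a single
idempotent at the bottom. -/
theorem val_cornerEvent_mul (a : Event k) (b : ZeroCorner 𝕜 ℓ k) :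
    (cornerEvent 𝕜 ℓ k a * b).1 = ev 𝕜 (a.right ℓ) * b.1 := by
  change ev 𝕜 (a.right ℓ) * eZero 𝕜 ℓ k * b.1 = _
  rw [mul_assoc, eZero_mul_val]

theorem val_cornerEvent (a : Event k) :
    (cornerEvent 𝕜 ℓ k a).1 = ev 𝕜 (a.right ℓ) * eZero 𝕜 ℓ k := rfl

theorem val_cornerEvent_pow (a : Event k) (n : ℕ) :
    (cornerEvent 𝕜 ℓ k a ^ n).1 = ev 𝕜 (a.right ℓ) ^ n * eZero 𝕜 ℓ k := by
  induction n with
  | zero => rw [pow_zero, pow_zero, one_mul]; rfl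
  | succ n ih => rw [pow_succ', val_cornerEvent_mul, ih, pow_succ', mul_assoc]

theorem col_zero_right (p : ℕ) : (Slice.zero ℓ k).col (ℓ + p) = .black := by
  simp [Slice.col_zero]

theorem lift_cornerEvent_rel ⦃a b : FreeAlgebra 𝕜 (Event k)⦄ (h : NilHeckeRel 𝕜 ℓ k a b) :
    FreeAlgebra.lift 𝕜 (cornerEvent 𝕜 ℓ k) a = FreeAlgebra.lift 𝕜 (cornerEvent 𝕜 ℓ k) b := by
  have val_sub (a b : ZeroCorner 𝕜 ℓ k) : (a - b).1 = a.1 - b.1 := rfl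
  have val_one : (1 : ZeroCorner 𝕜 ℓ k).1 = eZero 𝕜 ℓ k := rfl
  have val_zero : (0 : ZeroCorner 𝕜 ℓ k).1 = 0 := rfl
  apply Subtype.ext
  cases h with
  | dot_dot p q hp hq =>
    simp only [map_mul, FreeAlgebra.lift_ι_apply, val_cornerEvent_mul, val_cornerEvent]
    rw [← mul_assoc, ← mul_assoc]
    exact congrArg (· * _) (TAlg.dot_dot 𝕜 (ℓ + p) (ℓ + q) _ _)
  | dot_cross p q hp hq h₁ h₂ =>
    simp only [map_mul, FreeAlgebra.lift_ι_apply, val_cornerEvent_mul, val_cornerEvent]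
    rw [← mul_assoc, ← mul_assoc]
    exact congrArg (· * _) (TAlg.dot_cross 𝕜 (ℓ + p) (ℓ + q) _ _ (by omega) (by omega))
  | cross_cross p q hp hq h =>
    simp only [map_mul, FreeAlgebra.lift_ι_apply, val_cornerEvent_mul, val_cornerEvent]
    rw [← mul_assoc, ← mul_assoc]
    exact congrArg (· * _) (TAlg.cross_cross 𝕜 (ℓ + p) (ℓ + q) _ _ (by omega))
  | slide_top p hp =>
    simp only [map_mul, map_sub, map_one, FreeAlgebra.lift_ι_apply, val_sub, val_one,
      val_cornerEvent_mul, val_cornerEvent]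
    rw [← mul_assoc, ← mul_assoc, eZero_eq]
    exact TAlg.slide_top 𝕜 (p := ℓ + p) (by omega) (col_zero_right ℓ k p)
      (col_zero_right ℓ k (p + 1))
  | slide_bot p hp =>
    simp only [map_mul, map_sub, map_one, FreeAlgebra.lift_ι_apply, val_sub, val_one,
      val_cornerEvent_mul, val_cornerEvent]
    rw [← mul_assoc, ← mul_assoc, eZero_eq]
    exact TAlg.slide_bot 𝕜 (p := ℓ + p) (by omega) (col_zero_right ℓ k p)
      (col_zero_right ℓ k (p + 1))
  | bigon p hp =>
    simp only [map_mul, map_zero, FreeAlgebra.lift_ι_apply, val_zero, val_cornerEvent_mul,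
      val_cornerEvent]
    rw [← mul_assoc, eZero_eq]
    exact TAlg.bigon 𝕜 (p := ℓ + p) (by omega) (col_zero_right ℓ k p)
      (col_zero_right ℓ k (p + 1))
  | braid p hp =>
    simp only [map_mul, mul_assoc, FreeAlgebra.lift_ι_apply, val_cornerEvent_mul, val_cornerEvent]
    simp only [← mul_assoc, eZero_eq]
    exact TAlg.braid 𝕜 (p := ℓ + p) (by omega) (col_zero_right ℓ k p)
      (col_zero_right ℓ k (p + 1)) (col_zero_right ℓ k (p + 2))
  | cyclotomic hk =>
    simp only [map_pow, map_zero, FreeAlgebra.lift_ι_apply, val_zero, val_cornerEvent_pow]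
    rw [eZero_eq]
    -- The first black strand is in position `ℓ`, with exactly ℓ red strands on its left.
    exact TAlg.dot_pow_mul_E_eq_zero 𝕜 (p := ℓ) (by omega) (col_zero_right ℓ k 0)
      fun q hq => by simp [Slice.col_zero, hq]

/-- Placing a nilHecke diagram to the right of the red strands, as a map to the corner. -/
noncomputable def cornerHom : NilHecke 𝕜 ℓ k →ₐ[𝕜] ZeroCorner 𝕜 ℓ k :=
  RingQuot.liftAlgHom 𝕜 ⟨FreeAlgebra.lift 𝕜 (cornerEvent 𝕜 ℓ k), lift_cornerEvent_rel 𝕜 ℓ k⟩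

theorem cornerHom_mk (a : FreeAlgebra 𝕜 (Event k)) :
    cornerHom 𝕜 ℓ k (RingQuot.mkAlgHom 𝕜 _ a) = FreeAlgebra.lift 𝕜 (cornerEvent 𝕜 ℓ k) a :=
  RingQuot.liftAlgHom_mkAlgHom_apply _ _ _ _

theorem val_cornerHom_diagram (D : List (Event k)) :
    (cornerHom 𝕜 ℓ k (NilHecke.diagram 𝕜 ℓ k D)).1 =
      TAlg.diagram 𝕜 (D.map (Event.right ℓ)) (Slice.zero ℓ k) := by
  rw [NilHecke.diagram, cornerHom_mk]
  induction D with
  | nil => rw [List.map_nil, List.prod_nil, map_one]; rfl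
  | cons a D ih =>
    rw [List.map_cons, List.prod_cons, map_mul, FreeAlgebra.lift_ι_apply, val_cornerEvent_mul, ih]
    simp only [TAlg.diagram, List.map_cons, List.prod_cons, map_mul, mul_assoc, TAlg.ev]

end CornerHom

/-! ### Surjectivity -/

section Surjectivity

variable (𝕜 : Type*) [Field 𝕜] {ℓ k : ℕ}

open TAlg

/-- `Straight 𝕜 s a` means that `a` is a diagram from `Slice.zero` (at the bottom) to `s` (at the
top) without dots, in which no two black strands cross and no two strands cross twice. -/
inductive Straight : Slice ℓ k → TAlg 𝕜 ℓ k → Prop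
  | zero : Straight (Slice.zero ℓ k) (E 𝕜 (Slice.zero ℓ k))
  | cross (s : Slice ℓ k) (p : ℕ) (hp : p + 1 < ℓ + k) (a : TAlg 𝕜 ℓ k) (h₁ : s.col p = .black)
      (h₂ : s.col (p + 1) = .red) (h : Straight (s.swap p hp) a) : Straight s (X 𝕜 p hp * a)

theorem Straight.E_mul {s : Slice ℓ k} {a : TAlg 𝕜 ℓ k} (h : Straight 𝕜 s a) : E 𝕜 s * a = a := by
  induction h with
  | zero => exact E_mul_E_self 𝕜 _
  | cross s p hp a h₁ h₂ h ih =>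
    have hX := X_mul_E 𝕜 (s.swap p hp) p hp
    rw [Slice.swap_swap] at hX
    rw [← mul_assoc, ← hX, mul_assoc, ih]

theorem exists_straight (s : Slice ℓ k) : ∃ a, Straight 𝕜 s a := by
  induction hn : s.disorder using Nat.strong_induction_on generalizing s with
  | _ n ih =>
    by_cases hs : s = Slice.zero ℓ k
    · exact ⟨_, hs ▸ Straight.zero⟩
    · obtain ⟨p, hp, h₁, h₂⟩ := s.exists_black_red hs
      obtain ⟨a, ha⟩ := ih _ (hn ▸ s.disorder_swap_lt hp h₁ h₂) _ rfl
      exact ⟨_, .cross s p hp a h₁ h₂ ha⟩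

theorem Slice.zero_not_black_red {p : ℕ} (h₁ : (Slice.zero ℓ k).col p = .black)
    (h₂ : (Slice.zero ℓ k).col (p + 1) = .red) : False := by
  rw [Slice.col_zero] at h₁ h₂
  split_ifs at h₁ h₂
  omega

/-- A diamond argument. Two different choices of top crossing involve disjoint pairs of strands, so
both can be continued to a common straight diagram below, and distant crossings commute. -/
theorem Straight.unique {s : Slice ℓ k} {a b : TAlg 𝕜 ℓ k} (ha : Straight 𝕜 s a)
    (hb : Straight 𝕜 s b) : a = b := by
  induction hn : s.disorder using Nat.strong_induction_on generalizing s a b with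
  | _ n ih =>
    cases ha with
    | zero =>
      cases hb with
      | zero => rfl
      | cross _ p hp b h₁ h₂ hb => exact (Slice.zero_not_black_red h₁ h₂).elim
    | cross _ p hp a h₁ h₂ ha =>
      cases hb with
      | zero => exact (Slice.zero_not_black_red h₁ h₂).elim
      | cross _ q hq b h₃ h₄ hb =>
        have key : ∀ {p q : ℕ} {a b : TAlg 𝕜 ℓ k} (hp : p + 1 < ℓ + k) (hq : q + 1 < ℓ + k)
            (_ : s.col p = .black) (_ : s.col (p + 1) = .red)
            (_ : s.col q = .black) (_ : s.col (q + 1) = .red)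
            (_ : Straight 𝕜 (s.swap p hp) a) (_ : Straight 𝕜 (s.swap q hq) b) (_ : p + 1 < q),
            X 𝕜 p hp * a = X 𝕜 q hq * b := by
          intro p q a b hp hq h₁ h₂ h₃ h₄ ha hb hpq
          obtain ⟨c, hc⟩ := exists_straight 𝕜 ((s.swap p hp).swap q hq)
          have hca := Straight.cross (s.swap p hp) q hq c
            (by rwa [s.col_swap_of_ne hp (by omega) (by omega)])
            (by rwa [s.col_swap_of_ne hp (by omega) (by omega)]) hc
          rw [Slice.swap_comm _ _ _ hpq] at hc
          have hcb := Straight.cross (s.swap q hq) p hp c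
            (by rwa [s.col_swap_of_ne hq (by omega) (by omega)])
            (by rwa [s.col_swap_of_ne hq (by omega) (by omega)]) hc
          rw [ih _ (hn ▸ s.disorder_swap_lt hp h₁ h₂) ha hca rfl,
            ih _ (hn ▸ s.disorder_swap_lt hq h₃ h₄) hb hcb rfl, ← mul_assoc, ← mul_assoc,
            cross_cross 𝕜 p q hp hq hpq]
        rcases lt_trichotomy p q with h | rfl | h
        -- Adjacent choices would make position `p + 1` both red and black.
        · refine key hp hq h₁ h₂ h₃ h₄ ha hb (lt_of_le_of_ne h ?_)
          rintro rfl
          rw [h₂] at h₃; cases h₃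
        · rw [ih _ (hn ▸ s.disorder_swap_lt hp h₁ h₂) ha hb rfl]
        · refine (key hq hp h₃ h₄ h₁ h₂ hb ha (lt_of_le_of_ne h ?_)).symm
          rintro rfl
          rw [h₄] at h₁; cases h₁

/-- The crossing of a red strand and a black strand on its right extends a straight diagram. -/
theorem Straight.cross_red_black {s : Slice ℓ k} {a : TAlg 𝕜 ℓ k} (ha : Straight 𝕜 s a) {p : ℕ}
    (hp : p + 1 < ℓ + k) (h₁ : s.col p = .red) (h₂ : s.col (p + 1) = .black) :
    Straight 𝕜 (s.swap p hp) (X 𝕜 p hp * a) :=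
  .cross _ p hp a (by rwa [s.col_swap_left]) (by rwa [s.col_swap_right])
    (by rwa [Slice.swap_swap])

/-- A straight diagram ending in a slice with a black strand to the left of a red one can be
taken to end with their crossing. -/
theorem Straight.exists_eq_cross {s : Slice ℓ k} {a : TAlg 𝕜 ℓ k} (ha : Straight 𝕜 s a) {p : ℕ}
    (hp : p + 1 < ℓ + k) (h₁ : s.col p = .black) (h₂ : s.col (p + 1) = .red) :
    ∃ b, Straight 𝕜 (s.swap p hp) b ∧ a = X 𝕜 p hp * b := by
  obtain ⟨b, hb⟩ := exists_straight 𝕜 (s.swap p hp)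
  exact ⟨b, hb, ha.unique 𝕜 (.cross s p hp b h₁ h₂ hb)⟩

/-- A dot on top of a straight diagram can be moved to the bottom. -/
theorem Straight.dot_mul {s : Slice ℓ k} {a : TAlg 𝕜 ℓ k} (ha : Straight 𝕜 s a) {p : ℕ}
    (hp : p < ℓ + k) (h : s.col p = .black) :
    ∃ b : Event k, Y 𝕜 p hp * a = a * (cornerEvent 𝕜 ℓ k b).1 := by
  induction ha generalizing p with
  | zero =>
    rw [Slice.col_zero] at h
    split_ifs at h with hpl
    obtain ⟨j, rfl⟩ := Nat.exists_eq_add_of_le (not_lt.mp hpl)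
    refine ⟨.dot j (by omega), ?_⟩
    rw [← eZero_eq, eZero_mul_val, val_cornerEvent]
    rfl
  | cross s q hq a h₁ h₂ ha ih =>
    rcases eq_or_ne p q with rfl | hne
    · obtain ⟨b, hb⟩ := ih hq (by rwa [s.col_swap_right])
      refine ⟨b, ?_⟩
      -- Just below this crossing, the dotted black strand is to the right of the red one.
      have hs := slide_red_black 𝕜 (s := s.swap p hq) hq (by rwa [s.col_swap_left])
        (by rwa [s.col_swap_right])
      rw [← ha.E_mul, ← mul_assoc, ← mul_assoc, ← hs, mul_assoc, mul_assoc, ha.E_mul, hb,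
        mul_assoc]
    · have hne' : p ≠ q + 1 := by
        rintro rfl
        rw [h₂] at h; cases h
      obtain ⟨b, hb⟩ := ih hp (by rwa [s.col_swap_of_ne hq hne hne'])
      refine ⟨b, ?_⟩
      rw [← mul_assoc, dot_cross 𝕜 q p hq hp hne hne', mul_assoc, hb, mul_assoc]

/-- A crossing of black strands on top of a straight diagram can be moved to the bottom. -/
theorem Straight.cross_mul {s : Slice ℓ k} {a : TAlg 𝕜 ℓ k} (ha : Straight 𝕜 s a) {p : ℕ}
    (hp : p + 1 < ℓ + k) (h : s.col p = .black) (h' : s.col (p + 1) = .black) :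
    ∃ b : Event k, X 𝕜 p hp * a = a * (cornerEvent 𝕜 ℓ k b).1 := by
  induction hn : s.disorder using Nat.strong_induction_on generalizing s a p with
  | _ n ih =>
    cases ha with
    | zero =>
      rw [Slice.col_zero] at h
      split_ifs at h with hpl
      obtain ⟨j, rfl⟩ := Nat.exists_eq_add_of_le (not_lt.mp hpl)
      refine ⟨.cross j (by omega), ?_⟩
      rw [← eZero_eq, eZero_mul_val, val_cornerEvent]
      rfl
    | cross _ q hq a h₁ h₂ ha =>
      have hlt := s.disorder_swap_lt hq h₁ h₂
      have hqp : q ≠ p := by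
        rintro rfl
        rw [h₂] at h'; cases h'
      have hqp' : q + 1 ≠ p := by
        rintro rfl
        rw [h₂] at h; cases h
      rcases eq_or_ne q (p + 1) with rfl | hne
      · have hs₁ : (s.swap (p + 1) hq).col p = .black := by
          rwa [s.col_swap_of_ne hq (by omega) (by omega)]
        have hs₂ : (s.swap (p + 1) hq).col (p + 1) = .red := by rwa [s.col_swap_left]
        have hs₃ : (s.swap (p + 1) hq).col (p + 2) = .black := by rwa [s.col_swap_right]
        have hlt' := (s.swap (p + 1) hq).disorder_swap_lt hp hs₁ hs₂
        -- By uniqueness the next crossing can be taken between the same red strand and the other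
        -- black strand. The (rbb) triangle then moves the black crossing below both.
        obtain ⟨c, hc, rfl⟩ := ha.exists_eq_cross 𝕜 hp hs₁ hs₂
        have ht₁ : ((s.swap (p + 1) hq).swap p hp).col p = .red := by rwa [Slice.col_swap_left]
        have ht₂ : ((s.swap (p + 1) hq).swap p hp).col (p + 1) = .black := by
          rwa [Slice.col_swap_right]
        have ht₃ : ((s.swap (p + 1) hq).swap p hp).col (p + 2) = .black := by
          rwa [Slice.col_swap_of_ne _ _ (by omega) (by omega)]
        have hbr := braid_red_black_black 𝕜 hq ht₁ ht₂ ht₃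
        obtain ⟨b, hb⟩ := ih _ (hn ▸ hlt'.trans hlt) hc hq ht₂ ht₃ rfl
        refine ⟨b, ?_⟩
        calc X 𝕜 p hp * (X 𝕜 (p + 1) hq * (X 𝕜 p hp * c))
            = X 𝕜 p hp * X 𝕜 (p + 1) hq * X 𝕜 p hp *
                E 𝕜 ((s.swap (p + 1) hq).swap p hp) * c := by
              simp only [mul_assoc, hc.E_mul]
          _ = X 𝕜 (p + 1) hq * (X 𝕜 p hp * (X 𝕜 (p + 1) hq * c)) := by
              rw [hbr]; simp only [mul_assoc, hc.E_mul]
          _ = _ := by rw [hb]; simp only [mul_assoc]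
      · obtain ⟨b, hb⟩ := ih _ (hn ▸ hlt) ha hp
          (by rwa [s.col_swap_of_ne hq (by omega) (by omega)])
          (by rwa [s.col_swap_of_ne hq (by omega) (by omega)]) rfl
        refine ⟨b, ?_⟩
        have hcomm : X 𝕜 p hp * X 𝕜 q hq = X 𝕜 q hq * X 𝕜 p hp := by
          rcases lt_or_gt_of_ne hqp with hlt | hgt
          · exact (cross_cross 𝕜 q p hq hp (by omega)).symm
          · exact cross_cross 𝕜 p q hp hq (by omega)
        rw [← mul_assoc, hcomm, mul_assoc, hb, mul_assoc]

/-! ### A spanning set for `T e_0` -/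

variable (ℓ k) in
/-- The span of the diagrams that consist of a straight diagram on top of a nilHecke diagram. -/
noncomputable def straightSpan : Submodule 𝕜 (TAlg 𝕜 ℓ k) :=
  Submodule.span 𝕜 {t | ∃ s a, Straight 𝕜 s a ∧ ∃ r, t = a * (cornerHom 𝕜 ℓ k r).1}

theorem Straight.mul_mem {s : Slice ℓ k} {a : TAlg 𝕜 ℓ k} (ha : Straight 𝕜 s a)
    (r : NilHecke 𝕜 ℓ k) : a * (cornerHom 𝕜 ℓ k r).1 ∈ straightSpan 𝕜 ℓ k :=
  Submodule.subset_span ⟨s, a, ha, r, rfl⟩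

theorem Straight.mul_event_mul_mem {s : Slice ℓ k} {a : TAlg 𝕜 ℓ k} (ha : Straight 𝕜 s a)
    (b : Event k) (r : NilHecke 𝕜 ℓ k) :
    a * (cornerEvent 𝕜 ℓ k b).1 * (cornerHom 𝕜 ℓ k r).1 ∈ straightSpan 𝕜 ℓ k := by
  have h : (cornerHom 𝕜 ℓ k (RingQuot.mkAlgHom 𝕜 _ (FreeAlgebra.ι 𝕜 b) * r)).1 =
      (cornerEvent 𝕜 ℓ k b).1 * (cornerHom 𝕜 ℓ k r).1 := by
    rw [map_mul, cornerHom_mk, FreeAlgebra.lift_ι_apply]; rfl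
  rw [mul_assoc, ← h]
  exact ha.mul_mem 𝕜 _

/-- An idempotent keeps or kills the diagram, dots and black crossings descend, and a red-black
crossing lengthens the straight part. A black-red crossing repeats the top crossing, so the bigon
replaces the two by a dot, which descends. -/
theorem gen_mul_mem_straightSpan (g : Gen ℓ k) {t : TAlg 𝕜 ℓ k} (ht : t ∈ straightSpan 𝕜 ℓ k) :
    RingQuot.mkAlgHom 𝕜 (StendhalRel 𝕜 ℓ k) (FreeAlgebra.ι 𝕜 g) * t ∈ straightSpan 𝕜 ℓ k := by
  suffices h : straightSpan 𝕜 ℓ k ≤ (straightSpan 𝕜 ℓ k).comap (LinearMap.mulLeft 𝕜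
      (RingQuot.mkAlgHom 𝕜 (StendhalRel 𝕜 ℓ k) (FreeAlgebra.ι 𝕜 g))) from h ht
  refine Submodule.span_le.mpr ?_
  rintro _ ⟨s, a, ha, r, rfl⟩
  change RingQuot.mkAlgHom 𝕜 (StendhalRel 𝕜 ℓ k) (FreeAlgebra.ι 𝕜 g) *
    (a * (cornerHom 𝕜 ℓ k r).1) ∈ straightSpan 𝕜 ℓ k
  rw [← mul_assoc]
  match g with
  | .idem t =>
    change E 𝕜 t * a * _ ∈ _
    rw [← ha.E_mul, ← mul_assoc]
    by_cases hts : t = s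
    · rw [hts, E_mul_E_self, ha.E_mul]
      exact ha.mul_mem 𝕜 r
    · rw [E_mul_E_of_ne 𝕜 hts, zero_mul, zero_mul]
      exact zero_mem _
  | .event (.dot p hp) =>
    change Y 𝕜 p hp * a * _ ∈ _
    cases h : s.col p with
    | red =>
      rw [← ha.E_mul, ← mul_assoc, dot_red 𝕜 hp h, zero_mul, zero_mul]
      exact zero_mem _
    | black =>
      obtain ⟨b, hb⟩ := ha.dot_mul 𝕜 hp h
      rw [hb]
      exact ha.mul_event_mul_mem 𝕜 b r
  | .event (.cross p hp) =>
    change X 𝕜 p hp * a * _ ∈ _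
    cases h₁ : s.col p with
    | red =>
      cases h₂ : s.col (p + 1) with
      | red =>
        rw [← ha.E_mul, ← mul_assoc, cross_red 𝕜 hp h₁ h₂, zero_mul, zero_mul]
        exact zero_mem _
      | black => exact (ha.cross_red_black 𝕜 hp h₁ h₂).mul_mem 𝕜 r
    | black =>
      cases h₂ : s.col (p + 1) with
      | red =>
        obtain ⟨c, hc, rfl⟩ := ha.exists_eq_cross 𝕜 hp h₁ h₂
        obtain ⟨b, hb⟩ := hc.dot_mul 𝕜 hp (by rwa [s.col_swap_right])
        have h := bigon_red_black 𝕜 (s := s.swap p hp) hp (by rwa [s.col_swap_left])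
          (by rwa [s.col_swap_right])
        rw [← hc.E_mul, ← mul_assoc, ← mul_assoc, h, mul_assoc _ _ c, hc.E_mul, hb]
        exact hc.mul_event_mul_mem 𝕜 b r
      | black =>
        obtain ⟨b, hb⟩ := ha.cross_mul 𝕜 hp h₁ h₂
        rw [hb]
        exact ha.mul_event_mul_mem 𝕜 b r

theorem mul_mem_straightSpan (u : TAlg 𝕜 ℓ k) {t : TAlg 𝕜 ℓ k} (ht : t ∈ straightSpan 𝕜 ℓ k) :
    u * t ∈ straightSpan 𝕜 ℓ k := by
  obtain ⟨u, rfl⟩ := RingQuot.mkAlgHom_surjective 𝕜 (StendhalRel 𝕜 ℓ k) u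
  induction u generalizing t with
  | grade0 c =>
    rw [AlgHom.commutes, ← Algebra.smul_def]
    exact Submodule.smul_mem _ c ht
  | grade1 g => exact gen_mul_mem_straightSpan 𝕜 g ht
  | mul a b iha ihb => rw [map_mul, mul_assoc]; exact iha (ihb ht)
  | add a b iha ihb => rw [map_add, add_mul]; exact add_mem (iha ht) (ihb ht)

theorem eZero_mem_straightSpan : eZero 𝕜 ℓ k ∈ straightSpan 𝕜 ℓ k := by
  have h := (Straight.zero (𝕜 := 𝕜) (ℓ := ℓ) (k := k)).mul_mem 𝕜 1
  rwa [map_one, ← eZero_eq, eZero_mul_val] at h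

/-- e_0 kills straight diagrams that end in another slice; by uniqueness the one ending in
`Slice.zero` is e_0 itself. -/
theorem eZero_mul_of_mem_straightSpan {t : TAlg 𝕜 ℓ k} (ht : t ∈ straightSpan 𝕜 ℓ k) :
    ∃ r, (cornerHom 𝕜 ℓ k r).1 = eZero 𝕜 ℓ k * t := by
  induction ht using Submodule.span_induction with
  | mem t ht =>
    obtain ⟨s, a, ha, r, rfl⟩ := ht
    by_cases hs : s = Slice.zero ℓ k
    · subst hs
      refine ⟨r, ?_⟩
      rw [ha.unique 𝕜 .zero, ← eZero_eq, eZero_mul_val, eZero_mul_val]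
    · have h : eZero 𝕜 ℓ k * E 𝕜 s = 0 := by rw [eZero_eq, E_mul_E_of_ne 𝕜 (Ne.symm hs)]
      refine ⟨0, ?_⟩
      rw [← ha.E_mul, ← mul_assoc, ← mul_assoc, h, zero_mul, zero_mul, map_zero]
      rfl
  | zero => exact ⟨0, by rw [map_zero, mul_zero]; rfl⟩
  | add t u _ _ iht ihu =>
    obtain ⟨r, hr⟩ := iht
    obtain ⟨r', hr'⟩ := ihu
    exact ⟨r + r', by rw [map_add, mul_add, ← hr, ← hr']; rfl⟩
  | smul c t _ iht =>
    obtain ⟨r, hr⟩ := iht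
    exact ⟨c • r, by rw [map_smul, mul_smul_comm, ← hr]; rfl⟩

theorem cornerHom_surjective : Function.Surjective (cornerHom 𝕜 ℓ k) := by
  intro a
  obtain ⟨r, hr⟩ := eZero_mul_of_mem_straightSpan 𝕜
    (mul_mem_straightSpan 𝕜 a.1 (eZero_mem_straightSpan 𝕜))
  exact ⟨r, Subtype.ext (by rw [hr, val_mul_eZero, eZero_mul_val])⟩

end Surjectivity

/-! ### Relations in the cyclotomic nilHecke algebra -/

section NilHeckeRelations

variable (𝕜 : Type*) [Field 𝕜] (ℓ k : ℕ)

/-- The dot in position `j`, which is zero if there is no such position. -/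
noncomputable def NilHecke.Y (j : ℕ) : NilHecke 𝕜 ℓ k :=
  if h : j < k then RingQuot.mkAlgHom 𝕜 _ (FreeAlgebra.ι 𝕜 (.dot j h)) else 0

/-- The crossing in positions `j` and `j + 1`, which is zero if there are no such positions. -/
noncomputable def NilHecke.X (j : ℕ) : NilHecke 𝕜 ℓ k :=
  if h : j + 1 < k then RingQuot.mkAlgHom 𝕜 _ (FreeAlgebra.ι 𝕜 (.cross j h)) else 0

open NilHecke

theorem NilHecke.Y_mul_Y (i j : ℕ) : Y 𝕜 ℓ k i * Y 𝕜 ℓ k j = Y 𝕜 ℓ k j * Y 𝕜 ℓ k i := by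
  unfold NilHecke.Y
  split_ifs with hi hj
  · simpa only [map_mul] using
      RingQuot.mkAlgHom_rel 𝕜 (NilHeckeRel.dot_dot (𝕜 := 𝕜) (ℓ := ℓ) i j hi hj)
  all_goals simp

theorem NilHecke.Y_mul_X {i j : ℕ} (h₁ : i ≠ j) (h₂ : i ≠ j + 1) :
    Y 𝕜 ℓ k i * X 𝕜 ℓ k j = X 𝕜 ℓ k j * Y 𝕜 ℓ k i := by
  unfold NilHecke.Y NilHecke.X
  split_ifs with hi hj
  · simpa only [map_mul] using
      RingQuot.mkAlgHom_rel 𝕜 (NilHeckeRel.dot_cross (𝕜 := 𝕜) (ℓ := ℓ) j i hj hi h₁ h₂)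
  all_goals simp

theorem NilHecke.X_mul_X {i j : ℕ} (h : i + 1 < j) :
    X 𝕜 ℓ k i * X 𝕜 ℓ k j = X 𝕜 ℓ k j * X 𝕜 ℓ k i := by
  unfold NilHecke.X
  split_ifs with hi hj
  · simpa only [map_mul] using
      RingQuot.mkAlgHom_rel 𝕜 (NilHeckeRel.cross_cross (𝕜 := 𝕜) (ℓ := ℓ) i j hi hj h)
  all_goals simp

theorem NilHecke.slide_top {j : ℕ} (hj : j + 1 < k) :
    Y 𝕜 ℓ k j * X 𝕜 ℓ k j = X 𝕜 ℓ k j * Y 𝕜 ℓ k (j + 1) - 1 := by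
  have hj' : j < k := by omega
  simpa only [NilHecke.Y, NilHecke.X, hj, hj', dif_pos, map_mul, map_sub, map_one] using
    RingQuot.mkAlgHom_rel 𝕜 (NilHeckeRel.slide_top (𝕜 := 𝕜) (ℓ := ℓ) j hj)

theorem NilHecke.slide_bot {j : ℕ} (hj : j + 1 < k) :
    X 𝕜 ℓ k j * Y 𝕜 ℓ k j = Y 𝕜 ℓ k (j + 1) * X 𝕜 ℓ k j - 1 := by
  have hj' : j < k := by omega
  simpa only [NilHecke.Y, NilHecke.X, hj, hj', dif_pos, map_mul, map_sub, map_one] using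
    RingQuot.mkAlgHom_rel 𝕜 (NilHeckeRel.slide_bot (𝕜 := 𝕜) (ℓ := ℓ) j hj)

theorem NilHecke.bigon (j : ℕ) : X 𝕜 ℓ k j * X 𝕜 ℓ k j = 0 := by
  unfold NilHecke.X
  split_ifs with hj
  · simpa only [map_mul, map_zero] using
      RingQuot.mkAlgHom_rel 𝕜 (NilHeckeRel.bigon (𝕜 := 𝕜) (ℓ := ℓ) j hj)
  · simp

theorem NilHecke.braid {j : ℕ} (hj : j + 2 < k) :
    X 𝕜 ℓ k j * X 𝕜 ℓ k (j + 1) * X 𝕜 ℓ k j =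
      X 𝕜 ℓ k (j + 1) * X 𝕜 ℓ k j * X 𝕜 ℓ k (j + 1) := by
  have hj' : j + 1 < k := by omega
  have hj'' : j + 1 + 1 < k := by omega
  simpa only [NilHecke.X, hj', hj'', dif_pos, map_mul] using
    RingQuot.mkAlgHom_rel 𝕜 (NilHeckeRel.braid (𝕜 := 𝕜) (ℓ := ℓ) j hj)

theorem NilHecke.Y_zero_pow (hk : 0 < k) : Y 𝕜 ℓ k 0 ^ ℓ = 0 := by
  simpa only [NilHecke.Y, hk, dif_pos, map_pow, map_zero] using
    RingQuot.mkAlgHom_rel 𝕜 (NilHeckeRel.cyclotomic (𝕜 := 𝕜) (ℓ := ℓ) hk)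

/-- The product of the dots on two strands commutes with their crossing. -/
theorem NilHecke.X_commute_Y_mul_Y {j : ℕ} (hj : j + 1 < k) :
    X 𝕜 ℓ k j * (Y 𝕜 ℓ k j * Y 𝕜 ℓ k (j + 1)) = Y 𝕜 ℓ k j * Y 𝕜 ℓ k (j + 1) * X 𝕜 ℓ k j := by
  have h : X 𝕜 ℓ k j * Y 𝕜 ℓ k (j + 1) = Y 𝕜 ℓ k j * X 𝕜 ℓ k j + 1 := by
    rw [slide_top 𝕜 ℓ k hj, sub_add_cancel]
  rw [← mul_assoc, slide_bot 𝕜 ℓ k hj, sub_mul, mul_assoc, h, Y_mul_Y 𝕜 ℓ k j, mul_add, mul_one,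
    one_mul, add_sub_cancel_right, mul_assoc]

/-- Polynomials in the dots. -/
noncomputable def polyHom : MvPolynomial ℕ 𝕜 →ₐ[𝕜] NilHecke 𝕜 ℓ k :=
  -- `MvPolynomial.aeval` needs a commutative target, hence the detour through the subalgebra
  -- generated by the dots.
  haveI : IsMulCommutative (Algebra.adjoin 𝕜 (Set.range (NilHecke.Y 𝕜 ℓ k))) :=
    Algebra.isMulCommutative_adjoin 𝕜 (by
      rintro _ ⟨i, rfl⟩ _ ⟨j, rfl⟩
      exact NilHecke.Y_mul_Y 𝕜 ℓ k i j)
  open scoped IsMulCommutative in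
  (Algebra.adjoin 𝕜 (Set.range (NilHecke.Y 𝕜 ℓ k))).val.comp
    (MvPolynomial.aeval fun j => ⟨NilHecke.Y 𝕜 ℓ k j, Algebra.subset_adjoin ⟨j, rfl⟩⟩)

theorem polyHom_X (j : ℕ) : polyHom 𝕜 ℓ k (MvPolynomial.X j) = NilHecke.Y 𝕜 ℓ k j := by
  simp [polyHom]

/-- Unless `n = j + 1`, the monomial contains both or neither of the variables `j` and `j + 1`; in
the first case their product commutes with the crossing. -/
theorem polyHom_commute_X {j n : ℕ} (hj : j + 1 < k) (hn : n ≠ j + 1) :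
    Commute (NilHecke.X 𝕜 ℓ k j) (polyHom 𝕜 ℓ k (∏ i ∈ Finset.range n, MvPolynomial.X i)) := by
  induction n using Nat.strong_induction_on with
  | _ n ih =>
    match n with
    | 0 => simp
    | n + 1 =>
      rw [Finset.prod_range_succ]
      by_cases h : n = j + 1
      · subst h
        rw [Finset.prod_range_succ, mul_assoc, map_mul]
        refine (ih j (by omega) (by omega)).mul_right ?_
        rw [map_mul, polyHom_X, polyHom_X]
        exact NilHecke.X_commute_Y_mul_Y 𝕜 ℓ k hj
      · rw [map_mul, polyHom_X]
        exact (ih n (by omega) h).mul_right (NilHecke.Y_mul_X 𝕜 ℓ k (by omega) h).symm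

end NilHeckeRelations

/-! ### A representation of the algebra of Stendhal diagrams -/

section Representation

variable (𝕜 : Type*) [Field 𝕜] {ℓ k : ℕ}

/-- The action of a dot. -/
noncomputable def dotCoef (s : Slice ℓ k) (p : ℕ) : NilHecke 𝕜 ℓ k :=
  match s.col p with
  | .black => NilHecke.Y 𝕜 ℓ k (s.nblack p)
  | .red => 0

/-- The action of a crossing. -/
noncomputable def crossCoef (s : Slice ℓ k) (p : ℕ) : NilHecke 𝕜 ℓ k :=
  match s.col p, s.col (p + 1) with
  | .black, .black => NilHecke.X 𝕜 ℓ k (s.nblack p)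
  -- The dot of a red-black bigon is charged to one direction only: a black strand picks it up when
  -- it moves left through a red strand.
  | .black, .red => 1
  | .red, .black => NilHecke.Y 𝕜 ℓ k (s.nblack p)
  | .red, .red => 0

variable {𝕜} in
theorem dotCoef_black {s : Slice ℓ k} {p : ℕ} (h : s.col p = .black) :
    dotCoef 𝕜 s p = NilHecke.Y 𝕜 ℓ k (s.nblack p) := by
  simp [dotCoef, h]

variable {𝕜} in
theorem dotCoef_red {s : Slice ℓ k} {p : ℕ} (h : s.col p = .red) : dotCoef 𝕜 s p = 0 := by
  simp [dotCoef, h]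

variable {𝕜} in
theorem crossCoef_black_black {s : Slice ℓ k} {p : ℕ} (h₁ : s.col p = .black)
    (h₂ : s.col (p + 1) = .black) : crossCoef 𝕜 s p = NilHecke.X 𝕜 ℓ k (s.nblack p) := by
  simp [crossCoef, h₁, h₂]

variable {𝕜} in
theorem crossCoef_black_red {s : Slice ℓ k} {p : ℕ} (h₁ : s.col p = .black)
    (h₂ : s.col (p + 1) = .red) : crossCoef 𝕜 s p = 1 := by
  simp [crossCoef, h₁, h₂]

variable {𝕜} in
theorem crossCoef_red_black {s : Slice ℓ k} {p : ℕ} (h₁ : s.col p = .red)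
    (h₂ : s.col (p + 1) = .black) : crossCoef 𝕜 s p = NilHecke.Y 𝕜 ℓ k (s.nblack p) := by
  simp [crossCoef, h₁, h₂]

variable {𝕜} in
theorem crossCoef_red_red {s : Slice ℓ k} {p : ℕ} (h₁ : s.col p = .red)
    (h₂ : s.col (p + 1) = .red) : crossCoef 𝕜 s p = 0 := by
  simp [crossCoef, h₁, h₂]

theorem Slice.nblack_succ_of_black {s : Slice ℓ k} {p : ℕ} (h : s.col p = .black) :
    s.nblack (p + 1) = s.nblack p + 1 := by
  simp [Slice.nblack_succ, h]

theorem Slice.nblack_succ_of_red {s : Slice ℓ k} {p : ℕ} (h : s.col p = .red) :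
    s.nblack (p + 1) = s.nblack p := by
  simp [Slice.nblack_succ, h]

theorem dotCoef_swap_of_ne (s : Slice ℓ k) {p q : ℕ} (hp : p + 1 < ℓ + k) (h₁ : q ≠ p)
    (h₂ : q ≠ p + 1) : dotCoef 𝕜 (s.swap p hp) q = dotCoef 𝕜 s q := by
  have h : (s.swap p hp).nblack q = s.nblack q := by
    rcases lt_or_gt_of_ne h₁ with h | h
    · exact s.nblack_swap_of_le hp h.le
    · exact s.nblack_swap_of_lt hp (by omega)
  simp only [dotCoef, s.col_swap_of_ne hp h₁ h₂, h]

theorem crossCoef_swap_of_lt (s : Slice ℓ k) {p q : ℕ} (hp : p + 1 < ℓ + k) (h : p + 1 < q) :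
    crossCoef 𝕜 (s.swap p hp) q = crossCoef 𝕜 s q := by
  have h₁ := s.col_swap_of_ne hp (q := q) (by omega) (by omega)
  have h₂ := s.col_swap_of_ne hp (q := q + 1) (by omega) (by omega)
  simp only [crossCoef, h₁, h₂, s.nblack_swap_of_lt hp h]

theorem crossCoef_swap_of_gt (s : Slice ℓ k) {p q : ℕ} (hp : p + 1 < ℓ + k) (h : q + 1 < p) :
    crossCoef 𝕜 (s.swap p hp) q = crossCoef 𝕜 s q := by
  have h₁ := s.col_swap_of_ne hp (q := q) (by omega) (by omega)
  have h₂ := s.col_swap_of_ne hp (q := q + 1) (by omega) (by omega)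
  simp only [crossCoef, h₁, h₂, s.nblack_swap_of_le hp (show q ≤ p by omega)]

theorem dotCoef_comm (s : Slice ℓ k) (p q : ℕ) :
    dotCoef 𝕜 s p * dotCoef 𝕜 s q = dotCoef 𝕜 s q * dotCoef 𝕜 s p := by
  cases h₁ : s.col p <;> cases h₂ : s.col q <;>
    simp [dotCoef, h₁, h₂, NilHecke.Y_mul_Y 𝕜 ℓ k (s.nblack p)]

/-- Counting only black strands keeps disjoint events disjoint: the index of the dot is either below
`s.nblack p` or at least `s.nblack p + 2` when the crossing is black. -/
theorem dotCoef_crossCoef_comm (s : Slice ℓ k) {p q : ℕ} (hp : q ≠ p) (hp' : q ≠ p + 1) :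
    dotCoef 𝕜 s q * crossCoef 𝕜 s p = crossCoef 𝕜 s p * dotCoef 𝕜 s q := by
  cases hq : s.col q with
  | red => rw [dotCoef_red hq, zero_mul, mul_zero]
  | black =>
    rw [dotCoef_black hq]
    cases h₁ : s.col p <;> cases h₂ : s.col (p + 1)
    · rw [crossCoef_red_red h₁ h₂, zero_mul, mul_zero]
    · rw [crossCoef_red_black h₁ h₂, NilHecke.Y_mul_Y]
    · rw [crossCoef_black_red h₁ h₂, one_mul, mul_one]
    · rw [crossCoef_black_black h₁ h₂]
      have e₁ := Slice.nblack_succ_of_black h₁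
      have e₂ := Slice.nblack_succ_of_black h₂
      have e₃ := Slice.nblack_succ_of_black hq
      rcases lt_or_gt_of_ne hp with h | h
      · have := s.nblack_mono (show q + 1 ≤ p from h)
        exact NilHecke.Y_mul_X 𝕜 ℓ k (by omega) (by omega)
      · have := s.nblack_mono (show p + 1 + 1 ≤ q by omega)
        exact NilHecke.Y_mul_X 𝕜 ℓ k (by omega) (by omega)

theorem crossCoef_comm (s : Slice ℓ k) {p q : ℕ} (h : p + 1 < q) :
    crossCoef 𝕜 s p * crossCoef 𝕜 s q = crossCoef 𝕜 s q * crossCoef 𝕜 s p := by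
  have hm := s.nblack_mono (show p + 1 + 1 ≤ q by omega)
  cases h₁ : s.col p <;> cases h₂ : s.col (p + 1)
  · rw [crossCoef_red_red h₁ h₂, zero_mul, mul_zero]
  · rw [Slice.nblack_succ_of_black h₂, Slice.nblack_succ_of_red h₁] at hm
    rw [crossCoef_red_black h₁ h₂]
    cases h₃ : s.col q <;> cases h₄ : s.col (q + 1)
    · rw [crossCoef_red_red h₃ h₄, zero_mul, mul_zero]
    · rw [crossCoef_red_black h₃ h₄, NilHecke.Y_mul_Y]
    · rw [crossCoef_black_red h₃ h₄, one_mul, mul_one]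
    · rw [crossCoef_black_black h₃ h₄, NilHecke.Y_mul_X 𝕜 ℓ k (by omega) (by omega)]
  · rw [crossCoef_black_red h₁ h₂, one_mul, mul_one]
  · rw [Slice.nblack_succ_of_black h₂, Slice.nblack_succ_of_black h₁] at hm
    rw [crossCoef_black_black h₁ h₂]
    cases h₃ : s.col q <;> cases h₄ : s.col (q + 1)
    · rw [crossCoef_red_red h₃ h₄, zero_mul, mul_zero]
    · rw [crossCoef_red_black h₃ h₄, NilHecke.Y_mul_X 𝕜 ℓ k (by omega) (by omega)]
    · rw [crossCoef_black_red h₃ h₄, one_mul, mul_one]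
    · rw [crossCoef_black_black h₃ h₄, NilHecke.X_mul_X 𝕜 ℓ k (by omega)]

/-! ### Operators of the generators and their relations -/

/-- The operator on families of nilHecke elements by which a generator acts. -/
noncomputable def genOp : Gen ℓ k → Module.End 𝕜 (Slice ℓ k → NilHecke 𝕜 ℓ k)
  | .idem s => LinearMap.single 𝕜 (fun _ => NilHecke 𝕜 ℓ k) s ∘ₗ LinearMap.proj s
  | .event (.dot p _) => LinearMap.pi fun t =>
      LinearMap.mulLeft 𝕜 (dotCoef 𝕜 t p) ∘ₗ LinearMap.proj t
  -- Here `t` is the top slice, so the coefficient is read at the bottom slice `t.swap p hp`.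
  | .event (.cross p hp) => LinearMap.pi fun t =>
      LinearMap.mulLeft 𝕜 (crossCoef 𝕜 (t.swap p hp) p) ∘ₗ LinearMap.proj (t.swap p hp)

theorem genOp_idem (s : Slice ℓ k) (f : Slice ℓ k → NilHecke 𝕜 ℓ k) :
    genOp 𝕜 (.idem s) f = Pi.single s (f s) := rfl

theorem genOp_dot_apply (p : ℕ) (hp : p < ℓ + k) (f : Slice ℓ k → NilHecke 𝕜 ℓ k)
    (t : Slice ℓ k) : genOp 𝕜 (.event (.dot p hp)) f t = dotCoef 𝕜 t p * f t := rfl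

theorem genOp_cross_apply (p : ℕ) (hp : p + 1 < ℓ + k) (f : Slice ℓ k → NilHecke 𝕜 ℓ k)
    (t : Slice ℓ k) : genOp 𝕜 (.event (.cross p hp)) f t =
      crossCoef 𝕜 (t.swap p hp) p * f (t.swap p hp) := rfl

theorem genOp_dot_single (p : ℕ) (hp : p < ℓ + k) (s : Slice ℓ k) (r : NilHecke 𝕜 ℓ k) :
    genOp 𝕜 (.event (.dot p hp)) (Pi.single s r) = Pi.single s (dotCoef 𝕜 s p * r) := by
  funext t
  rw [genOp_dot_apply]
  by_cases h : t = s
  · subst h; simp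
  · simp [h]

theorem genOp_cross_single (p : ℕ) (hp : p + 1 < ℓ + k) (s : Slice ℓ k) (r : NilHecke 𝕜 ℓ k) :
    genOp 𝕜 (.event (.cross p hp)) (Pi.single s r) =
      Pi.single (s.swap p hp) (crossCoef 𝕜 s p * r) := by
  funext t
  rw [genOp_cross_apply]
  by_cases h : t = s.swap p hp
  · subst h; simp [Slice.swap_swap]
  · have h' : t.swap p hp ≠ s := by
      rintro rfl
      exact h (Slice.swap_swap _ _ _).symm
    simp [h, h']

/-- The operators `genOp` satisfy all relations but the violating one. -/
theorem lift_genOp_rel {a b : FreeAlgebra 𝕜 (Gen ℓ k)} (h : StendhalRel 𝕜 ℓ k a b) :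
    FreeAlgebra.lift 𝕜 (genOp 𝕜) a = FreeAlgebra.lift 𝕜 (genOp 𝕜) b ∨
      ∃ s : Slice ℓ k, s.col 0 = .black ∧ 0 < ℓ + k ∧ a = e 𝕜 s ∧ b = 0 := by
  have hk : ∀ (s : Slice ℓ k) {p : ℕ}, p + 1 < ℓ + k → s.col p = .black →
      s.col (p + 1) = .black → s.nblack p + 1 < k := fun s p hp h₁ h₂ => by
    have := s.nblack_le (show p + 1 + 1 ≤ ℓ + k from hp)
    rw [Slice.nblack_succ_of_black h₂, Slice.nblack_succ_of_black h₁] at this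
    omega
  cases h with
  | violating s h0 h => exact .inr ⟨s, by rwa [Slice.col_eq _ h0], h0, rfl, rfl⟩
  | idem_idem s =>
    left
    refine LinearMap.ext fun f => ?_
    simp [e, genOp_idem]
  | idem_ne s t h =>
    left
    refine LinearMap.ext fun f => ?_
    simp [e, genOp_idem, h]
  | idem_sum =>
    left
    refine LinearMap.ext fun f => ?_
    simp only [e, map_sum, FreeAlgebra.lift_ι_apply, map_one, LinearMap.sum_apply, genOp_idem]
    exact Finset.univ_sum_single f
  | dot_idem s p hp =>
    left
    refine LinearMap.ext fun f => ?_
    simp [e, y, genOp_idem, genOp_dot_single, genOp_dot_apply]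
  | cross_idem s p hp =>
    left
    refine LinearMap.ext fun f => ?_
    simp [e, x, genOp_idem, genOp_cross_single, genOp_cross_apply, Slice.swap_swap]
  | dot_red s p hp h =>
    left
    refine LinearMap.ext fun f => ?_
    rw [← Slice.col_eq] at h
    simp [e, y, genOp_idem, genOp_dot_single, dotCoef_red h]
  | cross_red s p hp h₁ h₂ =>
    left
    refine LinearMap.ext fun f => ?_
    rw [← Slice.col_eq] at h₁ h₂
    simp [e, x, genOp_idem, genOp_cross_single, crossCoef_red_red h₁ h₂]
  | dot_dot p q hp hq =>
    left
    refine LinearMap.pi_ext fun s r => ?_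
    simp [y, genOp_dot_single, ← mul_assoc, dotCoef_comm 𝕜 s p q]
  | dot_cross p q hp hq h₁ h₂ =>
    left
    refine LinearMap.pi_ext fun s r => ?_
    simp [x, y, genOp_dot_single, genOp_cross_single, ← mul_assoc,
      dotCoef_swap_of_ne 𝕜 s hp h₁ h₂, dotCoef_crossCoef_comm 𝕜 s h₁ h₂]
  | cross_cross p q hp hq h =>
    left
    refine LinearMap.pi_ext fun s r => ?_
    simp [x, genOp_cross_single, ← mul_assoc, crossCoef_swap_of_lt 𝕜 s hp h,
      crossCoef_swap_of_gt 𝕜 s hq h, crossCoef_comm 𝕜 s h, Slice.swap_comm s hp hq h]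
  | slide_top s p hp h₁ h₂ =>
    left
    refine LinearMap.ext fun f => ?_
    rw [← Slice.col_eq] at h₁ h₂
    have hs := s.swap_eq_self hp (h₁.trans h₂.symm)
    simp only [e, x, y, map_mul, map_sub, FreeAlgebra.lift_ι_apply, Module.End.mul_apply,
      LinearMap.sub_apply, genOp_idem, genOp_dot_single, genOp_cross_single, hs]
    rw [← Pi.single_sub, dotCoef_black h₁, dotCoef_black h₂, crossCoef_black_black h₁ h₂,
      Slice.nblack_succ_of_black h₁, ← mul_assoc, ← mul_assoc,
      NilHecke.slide_top 𝕜 ℓ k (hk s hp h₁ h₂), sub_mul, one_mul]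
  | slide_bot s p hp h₁ h₂ =>
    left
    refine LinearMap.ext fun f => ?_
    rw [← Slice.col_eq] at h₁ h₂
    have hs := s.swap_eq_self hp (h₁.trans h₂.symm)
    simp only [e, x, y, map_mul, map_sub, FreeAlgebra.lift_ι_apply, Module.End.mul_apply,
      LinearMap.sub_apply, genOp_idem, genOp_dot_single, genOp_cross_single, hs]
    rw [← Pi.single_sub, dotCoef_black h₁, dotCoef_black h₂, crossCoef_black_black h₁ h₂,
      Slice.nblack_succ_of_black h₁, ← mul_assoc, ← mul_assoc,
      NilHecke.slide_bot 𝕜 ℓ k (hk s hp h₁ h₂), sub_mul, one_mul]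
  | bigon s p hp h₁ h₂ =>
    left
    refine LinearMap.ext fun f => ?_
    rw [← Slice.col_eq] at h₁ h₂
    have hs := s.swap_eq_self hp (h₁.trans h₂.symm)
    simp only [e, x, map_mul, map_zero, FreeAlgebra.lift_ι_apply, Module.End.mul_apply,
      LinearMap.zero_apply, genOp_idem, genOp_cross_single, hs]
    rw [crossCoef_black_black h₁ h₂, ← mul_assoc, NilHecke.bigon, zero_mul, Pi.single_zero]
  | braid s p hp h₁ h₂ h₃ =>
    left
    refine LinearMap.ext fun f => ?_
    rw [← Slice.col_eq] at h₁ h₂ h₃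
    have hs := s.swap_eq_self (p := p) (by omega) (h₁.trans h₂.symm)
    have hs' := s.swap_eq_self (p := p + 1) hp (h₂.trans h₃.symm)
    have hk' := hk s hp h₂ h₃
    rw [Slice.nblack_succ_of_black h₁] at hk'
    simp only [e, x, map_mul, FreeAlgebra.lift_ι_apply, Module.End.mul_apply,
      genOp_idem, genOp_cross_single, hs, hs']
    rw [crossCoef_black_black h₁ h₂, crossCoef_black_black h₂ h₃, Slice.nblack_succ_of_black h₁]
    simp only [← mul_assoc]
    rw [NilHecke.braid 𝕜 ℓ k hk']
  | braid_black_red_black s p hp h₁ h₂ h₃ =>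
    left
    refine LinearMap.ext fun f => ?_
    rw [← Slice.col_eq] at h₁ h₂ h₃
    have hp' : p + 1 < ℓ + k := by omega
    have t₁ : (s.swap p hp').col p = .red := by rw [s.col_swap_left, h₂]
    have t₂ : (s.swap p hp').col (p + 1) = .black := by rw [s.col_swap_right, h₁]
    have t₃ : (s.swap p hp').col (p + 2) = .black := by
      rw [s.col_swap_of_ne hp' (by omega) (by omega), h₃]
    have u₁ : (s.swap (p + 1) hp).col p = .black := by
      rw [s.col_swap_of_ne hp (by omega) (by omega), h₁]
    have u₂ : (s.swap (p + 1) hp).col (p + 1) = .black := by rw [s.col_swap_left, h₃]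
    have u₃ : (s.swap (p + 1) hp).col (p + 2) = .red := by rw [s.col_swap_right, h₂]
    have ht := (s.swap p hp').swap_eq_self hp (t₂.trans t₃.symm)
    have hu := (s.swap (p + 1) hp).swap_eq_self hp' (u₁.trans u₂.symm)
    have hk' := hk _ hp' u₁ u₂
    simp only [e, x, map_mul, map_sub, FreeAlgebra.lift_ι_apply, Module.End.mul_apply,
      LinearMap.sub_apply, genOp_idem, genOp_cross_single, ht, hu, Slice.swap_swap]
    rw [s.nblack_swap_of_le hp (by omega)] at hk'
    rw [crossCoef_black_red h₁ h₂, crossCoef_black_black t₂ t₃, crossCoef_red_black t₁ t₂,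
      crossCoef_red_black h₂ h₃, crossCoef_black_black u₁ u₂, crossCoef_black_red u₂ u₃,
      Slice.nblack_succ_of_red t₁, s.nblack_swap_of_le hp' le_rfl,
      s.nblack_swap_of_le hp (by omega), Slice.nblack_succ_of_black h₁, ← Pi.single_sub]
    simp only [one_mul, ← mul_assoc]
    -- Around the red strand, the left black strand picks up its dot above the crossing on one side
    -- of the relation, and the right one below it on the other. The correction term is thus that of
    -- the nilHecke dot slide.
    rw [NilHecke.slide_top 𝕜 ℓ k hk', sub_mul, one_mul]
  | braid_black_black_red s p hp h₁ h₂ h₃ =>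
    left
    refine LinearMap.ext fun f => ?_
    rw [← Slice.col_eq] at h₁ h₂ h₃
    have hp' : p + 1 < ℓ + k := by omega
    have hs := s.swap_eq_self hp' (h₁.trans h₂.symm)
    have t₁ : (s.swap (p + 1) hp).col p = .black := by
      rw [s.col_swap_of_ne hp (by omega) (by omega), h₁]
    have t₂ : (s.swap (p + 1) hp).col (p + 1) = .red := by rw [s.col_swap_left, h₃]
    have t₃ : (s.swap (p + 1) hp).col (p + 2) = .black := by rw [s.col_swap_right, h₂]
    have u₁ : ((s.swap (p + 1) hp).swap p hp').col p = .red := by rw [Slice.col_swap_left, t₂]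
    have u₂ : ((s.swap (p + 1) hp).swap p hp').col (p + 1) = .black := by
      rw [Slice.col_swap_right, t₁]
    have u₃ : ((s.swap (p + 1) hp).swap p hp').col (p + 2) = .black := by
      rw [Slice.col_swap_of_ne _ hp' (by omega) (by omega), t₃]
    have hu := ((s.swap (p + 1) hp).swap p hp').swap_eq_self hp (u₂.trans u₃.symm)
    simp only [e, x, map_mul, FreeAlgebra.lift_ι_apply, Module.End.mul_apply,
      genOp_idem, genOp_cross_single, hs, hu]
    rw [crossCoef_black_black h₁ h₂, crossCoef_black_red h₂ h₃, crossCoef_black_red t₁ t₂,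
      crossCoef_black_black u₂ u₃, Slice.nblack_succ_of_red u₁, Slice.nblack_swap_of_le _ _ le_rfl,
      Slice.nblack_swap_of_le _ _ (by omega)]
    simp only [one_mul]
  | braid_red_black_black s p hp h₁ h₂ h₃ =>
    left
    refine LinearMap.ext fun f => ?_
    rw [← Slice.col_eq] at h₁ h₂ h₃
    have hp' : p + 1 < ℓ + k := by omega
    have hs := s.swap_eq_self hp (h₂.trans h₃.symm)
    have t₁ : (s.swap p hp').col p = .black := by rw [s.col_swap_left, h₂]
    have t₂ : (s.swap p hp').col (p + 1) = .red := by rw [s.col_swap_right, h₁]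
    have t₃ : (s.swap p hp').col (p + 2) = .black := by
      rw [s.col_swap_of_ne hp' (by omega) (by omega), h₃]
    have u₁ : ((s.swap p hp').swap (p + 1) hp).col p = .black := by
      rw [Slice.col_swap_of_ne _ hp (by omega) (by omega), t₁]
    have u₂ : ((s.swap p hp').swap (p + 1) hp).col (p + 1) = .black := by
      rw [Slice.col_swap_left, t₃]
    have hu := ((s.swap p hp').swap (p + 1) hp).swap_eq_self hp' (u₁.trans u₂.symm)
    have hk' := hk s hp h₂ h₃
    rw [Slice.nblack_succ_of_red h₁] at hk'
    simp only [e, x, map_mul, FreeAlgebra.lift_ι_apply, Module.End.mul_apply,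
      genOp_idem, genOp_cross_single, hs, hu]
    rw [crossCoef_black_black h₂ h₃, crossCoef_red_black h₁ h₂, crossCoef_red_black t₂ t₃,
      crossCoef_black_black u₁ u₂, Slice.nblack_succ_of_black t₁,
      Slice.nblack_swap_of_le _ _ (by omega), Slice.nblack_swap_of_le _ _ le_rfl,
      Slice.nblack_succ_of_red h₁]
    simp only [← mul_assoc]
    -- Both black strands pass the red one, so the crossing meets the symmetric product of their
    -- dots.
    rw [mul_assoc (NilHecke.X 𝕜 ℓ k _), NilHecke.Y_mul_Y 𝕜 ℓ k (s.nblack p + 1),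
      NilHecke.X_commute_Y_mul_Y 𝕜 ℓ k hk']
  | slide_black_red s p hp h₁ h₂ =>
    left
    refine LinearMap.ext fun f => ?_
    rw [← Slice.col_eq] at h₁ h₂
    have t : (s.swap p hp).col (p + 1) = .black := by rw [s.col_swap_right, h₁]
    have t' : (s.swap p hp).col p = .red := by rw [s.col_swap_left, h₂]
    simp only [e, x, y, map_mul, FreeAlgebra.lift_ι_apply, Module.End.mul_apply,
      genOp_idem, genOp_dot_single, genOp_cross_single]
    rw [crossCoef_black_red h₁ h₂, dotCoef_black h₁, dotCoef_black t,
      Slice.nblack_succ_of_red t', s.nblack_swap_of_le hp le_rfl, one_mul, one_mul]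
  | slide_red_black s p hp h₁ h₂ =>
    left
    refine LinearMap.ext fun f => ?_
    rw [← Slice.col_eq] at h₁ h₂
    have t : (s.swap p hp).col p = .black := by rw [s.col_swap_left, h₂]
    simp only [e, x, y, map_mul, FreeAlgebra.lift_ι_apply, Module.End.mul_apply,
      genOp_idem, genOp_dot_single, genOp_cross_single]
    rw [crossCoef_red_black h₁ h₂, dotCoef_black h₂, dotCoef_black t,
      Slice.nblack_succ_of_red h₁, s.nblack_swap_of_le hp le_rfl]
  | bigon_black_red s p hp h₁ h₂ =>
    left
    refine LinearMap.ext fun f => ?_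
    rw [← Slice.col_eq] at h₁ h₂
    have t : (s.swap p hp).col (p + 1) = .black := by rw [s.col_swap_right, h₁]
    have t' : (s.swap p hp).col p = .red := by rw [s.col_swap_left, h₂]
    simp only [e, x, y, map_mul, FreeAlgebra.lift_ι_apply, Module.End.mul_apply,
      genOp_idem, genOp_dot_single, genOp_cross_single, Slice.swap_swap]
    rw [crossCoef_black_red h₁ h₂, crossCoef_red_black t' t, dotCoef_black h₁,
      s.nblack_swap_of_le hp le_rfl, one_mul]
  | bigon_red_black s p hp h₁ h₂ =>
    left
    refine LinearMap.ext fun f => ?_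
    rw [← Slice.col_eq] at h₁ h₂
    have t : (s.swap p hp).col p = .black := by rw [s.col_swap_left, h₂]
    have t' : (s.swap p hp).col (p + 1) = .red := by rw [s.col_swap_right, h₁]
    simp only [e, x, y, map_mul, FreeAlgebra.lift_ι_apply, Module.End.mul_apply,
      genOp_idem, genOp_dot_single, genOp_cross_single, Slice.swap_swap]
    rw [crossCoef_red_black h₁ h₂, crossCoef_black_red t t', dotCoef_black h₂,
      Slice.nblack_succ_of_red h₁, one_mul]

/-! ### The monomials of slices and the invariant subspace -/

/-- The monomial that moving the red strands from the left to their positions in `s` contributes: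
a dot on a black strand for every red strand on its right. -/
noncomputable def sliceMonomial (s : Slice ℓ k) : MvPolynomial ℕ 𝕜 :=
  s.redProd fun n => ∏ i ∈ Finset.range n, MvPolynomial.X i

theorem sliceMonomial_swap (s : Slice ℓ k) {p : ℕ} (hp : p + 1 < ℓ + k) (h₁ : s.col p = .red)
    (h₂ : s.col (p + 1) = .black) :
    sliceMonomial 𝕜 (s.swap p hp) = MvPolynomial.X (s.nblack p) * sliceMonomial 𝕜 s :=
  s.redProd_swap hp h₁ h₂ (by rw [Finset.prod_range_succ, mul_comm])

theorem sliceMonomial_zero : sliceMonomial 𝕜 (Slice.zero ℓ k) = 1 := by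
  rw [sliceMonomial, Slice.redProd_eq]
  refine Finset.prod_eq_one fun q hq => ?_
  rw [Slice.mem_reds, Slice.col_zero] at hq
  split_ifs at hq with h
  have hn := (Slice.zero ℓ k).nblack_mono (show q ≤ ℓ + 0 by omega)
  rw [Slice.nblack_zero_slice, Nat.le_zero] at hn
  rw [hn, Finset.prod_range_zero]

/-- All ℓ red strands are to the right of the first black strand, so the monomial is divisible by
the ℓ-th power of its dot. -/
theorem polyHom_sliceMonomial_eq_zero {s : Slice ℓ k} (h0 : 0 < ℓ + k) (h : s.col 0 = .black) :
    polyHom 𝕜 ℓ k (sliceMonomial 𝕜 s) = 0 := by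
  have hn : s.nblack 1 = 1 := by
    rw [Slice.nblack_succ_of_black h, Slice.nblack, Nat.count_zero]
  have hk : 0 < k := by
    have := s.nblack_le (show 1 ≤ ℓ + k from h0)
    omega
  have hdvd : ∏ _q ∈ s.reds, (MvPolynomial.X 0 : MvPolynomial ℕ 𝕜) ∣ sliceMonomial 𝕜 s := by
    rw [sliceMonomial, Slice.redProd_eq]
    refine Finset.prod_dvd_prod_of_dvd _ _ fun q hq => Finset.dvd_prod_of_mem _ ?_
    rw [Slice.mem_reds] at hq
    have hq0 : q ≠ 0 := by
      rintro rfl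
      rw [h] at hq; cases hq
    have := s.nblack_mono (show 1 ≤ q by omega)
    rw [Finset.mem_range]
    omega
  obtain ⟨f, hf⟩ := hdvd
  rw [hf, Finset.prod_const, s.card_reds, map_mul, map_pow, polyHom_X,
    NilHecke.Y_zero_pow 𝕜 ℓ k hk, zero_mul]

/-- No red strand separates two adjacent black strands, so the factor of each red strand contains
both of their dots or neither. -/
theorem X_commute_sliceMonomial {s : Slice ℓ k} {p : ℕ} (hp : p + 1 < ℓ + k)
    (h₁ : s.col p = .black) (h₂ : s.col (p + 1) = .black) :
    Commute (NilHecke.X 𝕜 ℓ k (s.nblack p)) (polyHom 𝕜 ℓ k (sliceMonomial 𝕜 s)) := by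
  have e₁ := Slice.nblack_succ_of_black h₁
  have e₂ := Slice.nblack_succ_of_black h₂
  have hk := s.nblack_le (show p + 1 + 1 ≤ ℓ + k from hp)
  rw [sliceMonomial, Slice.redProd_eq]
  refine Finset.prod_induction _
    (fun f => Commute (NilHecke.X 𝕜 ℓ k (s.nblack p)) (polyHom 𝕜 ℓ k f))
    (fun f g hf hg => by rw [map_mul]; exact hf.mul_right hg) (by simp) fun q hq => ?_
  refine polyHom_commute_X 𝕜 ℓ k (by omega) ?_
  rw [Slice.mem_reds] at hq
  rcases lt_or_ge q (p + 1) with h | h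
  · have := s.nblack_mono (show q ≤ p by omega)
    omega
  · have hne : q ≠ p + 1 := by
      rintro rfl
      rw [h₂] at hq; cases hq
    have := s.nblack_mono (show p + 1 + 1 ≤ q by omega)
    omega

variable (ℓ k) in
/-- The families whose component at a slice `s` lies in the right ideal generated by the monomial
of `s`. -/
noncomputable def idealFamilies : Submodule 𝕜 (Slice ℓ k → NilHecke 𝕜 ℓ k) :=
  Submodule.pi Set.univ fun s =>
    LinearMap.range (LinearMap.mulLeft 𝕜 (polyHom 𝕜 ℓ k (sliceMonomial 𝕜 s)))

theorem mem_idealFamilies {f : Slice ℓ k → NilHecke 𝕜 ℓ k} :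
    f ∈ idealFamilies 𝕜 ℓ k ↔ ∀ s, ∃ r, polyHom 𝕜 ℓ k (sliceMonomial 𝕜 s) * r = f s := by
  simp [idealFamilies, Submodule.mem_pi]

theorem Y_mul_polyHom (j : ℕ) (f : MvPolynomial ℕ 𝕜) :
    NilHecke.Y 𝕜 ℓ k j * polyHom 𝕜 ℓ k f = polyHom 𝕜 ℓ k f * NilHecke.Y 𝕜 ℓ k j := by
  rw [← polyHom_X, ← map_mul, ← map_mul, mul_comm]

/-- Coefficients of dots and black crossings commute with the monomial of the slice. The coefficient
of a red-black crossing is exactly the factor by which the monomial grows. -/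
theorem genOp_mem_idealFamilies (g : Gen ℓ k) {f : Slice ℓ k → NilHecke 𝕜 ℓ k}
    (hf : f ∈ idealFamilies 𝕜 ℓ k) : genOp 𝕜 g f ∈ idealFamilies 𝕜 ℓ k := by
  rw [mem_idealFamilies] at hf ⊢
  intro t
  match g with
  | .idem s =>
    rw [genOp_idem]
    by_cases h : t = s
    · subst h
      simpa using hf t
    · exact ⟨0, by simp [h]⟩
  | .event (.dot p hp) =>
    rw [genOp_dot_apply]
    obtain ⟨r, hr⟩ := hf t
    rw [← hr]
    cases h : t.col p with
    | red => exact ⟨0, by rw [dotCoef_red h, zero_mul, mul_zero]⟩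
    | black =>
      exact ⟨NilHecke.Y 𝕜 ℓ k (t.nblack p) * r, by
        rw [dotCoef_black h, ← mul_assoc, ← mul_assoc, Y_mul_polyHom]⟩
  | .event (.cross p hp) =>
    rw [genOp_cross_apply]
    obtain ⟨s, rfl⟩ : ∃ s : Slice ℓ k, s.swap p hp = t := ⟨t.swap p hp, t.swap_swap p hp⟩
    rw [Slice.swap_swap]
    obtain ⟨r, hr⟩ := hf s
    rw [← hr]
    cases h₁ : s.col p <;> cases h₂ : s.col (p + 1)
    · exact ⟨0, by rw [crossCoef_red_red h₁ h₂, zero_mul, mul_zero]⟩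
    · exact ⟨r, by
        rw [sliceMonomial_swap 𝕜 s hp h₁ h₂, crossCoef_red_black h₁ h₂, map_mul, polyHom_X,
          mul_assoc]⟩
    -- In this direction the coefficient is 1 and the monomial loses a factor, so the old ideal lies
    -- in the new one.
    · have h := sliceMonomial_swap 𝕜 (s.swap p hp) hp (by rwa [s.col_swap_left])
        (by rwa [s.col_swap_right])
      rw [Slice.swap_swap, mul_comm] at h
      exact ⟨_, by rw [crossCoef_black_red h₁ h₂, h, map_mul, one_mul, mul_assoc]⟩
    · exact ⟨NilHecke.X 𝕜 ℓ k (s.nblack p) * r, by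
        rw [crossCoef_black_black h₁ h₂, s.swap_eq_self hp (h₁.trans h₂.symm), ← mul_assoc,
          ← mul_assoc, (X_commute_sliceMonomial 𝕜 hp h₁ h₂).eq]⟩

/-- The action of the free algebra on `idealFamilies`. -/
noncomputable def freeRep : FreeAlgebra 𝕜 (Gen ℓ k) →ₐ[𝕜] Module.End 𝕜 (idealFamilies 𝕜 ℓ k) :=
  FreeAlgebra.lift 𝕜 fun g => (genOp 𝕜 g).restrict fun _ hf => genOp_mem_idealFamilies 𝕜 g hf

theorem val_freeRep (a : FreeAlgebra 𝕜 (Gen ℓ k)) (f : idealFamilies 𝕜 ℓ k) :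
    (freeRep 𝕜 a f).1 = FreeAlgebra.lift 𝕜 (genOp 𝕜) a f.1 := by
  induction a generalizing f with
  | grade0 c => simp [Module.algebraMap_end_apply]
  | grade1 g => simp [freeRep]
  | mul a b iha ihb => simp [iha, ihb]
  | add a b iha ihb => simp [iha, ihb]

/-- The violating relation holds only after restriction: the component at such a slice lies in the
zero ideal. -/
theorem freeRep_rel ⦃a b : FreeAlgebra 𝕜 (Gen ℓ k)⦄ (h : StendhalRel 𝕜 ℓ k a b) :
    freeRep 𝕜 a = freeRep 𝕜 b := by
  refine LinearMap.ext fun f => Subtype.ext ?_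
  rw [val_freeRep, val_freeRep]
  rcases lift_genOp_rel 𝕜 h with h | ⟨s, hs, h0, rfl, rfl⟩
  · rw [h]
  · obtain ⟨r, hr⟩ := (mem_idealFamilies 𝕜).mp f.2 s
    rw [polyHom_sliceMonomial_eq_zero 𝕜 h0 hs, zero_mul] at hr
    rw [e, FreeAlgebra.lift_ι_apply, genOp_idem, ← hr]
    simp

variable (ℓ k) in
/-- The action of the algebra of Stendhal diagrams on `idealFamilies`. -/
noncomputable def stendhalRep : TAlg 𝕜 ℓ k →ₐ[𝕜] Module.End 𝕜 (idealFamilies 𝕜 ℓ k) :=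
  RingQuot.liftAlgHom 𝕜 ⟨freeRep 𝕜, freeRep_rel 𝕜⟩

theorem val_stendhalRep_mk (a : FreeAlgebra 𝕜 (Gen ℓ k)) (f : idealFamilies 𝕜 ℓ k) :
    (stendhalRep 𝕜 ℓ k (RingQuot.mkAlgHom 𝕜 _ a) f).1 =
      FreeAlgebra.lift 𝕜 (genOp 𝕜) a f.1 := by
  rw [← val_freeRep, stendhalRep, RingQuot.liftAlgHom_mkAlgHom_apply]

/-! ### Injectivity -/

/-- The family concentrated in `Slice.zero` with the value `r` there. -/
noncomputable def zeroFamily (r : NilHecke 𝕜 ℓ k) : idealFamilies 𝕜 ℓ k :=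
  ⟨Pi.single (Slice.zero ℓ k) r, (mem_idealFamilies 𝕜).mpr fun s => by
    by_cases h : s = Slice.zero ℓ k
    · subst h
      exact ⟨r, by rw [sliceMonomial_zero, map_one, one_mul, Pi.single_eq_same]⟩
    · exact ⟨0, by simp [h]⟩⟩

theorem stendhalRep_eZero (r : NilHecke 𝕜 ℓ k) :
    stendhalRep 𝕜 ℓ k (eZero 𝕜 ℓ k) (zeroFamily 𝕜 r) = zeroFamily 𝕜 r := by
  apply Subtype.ext
  rw [eZero_eq, TAlg.E, val_stendhalRep_mk, e, FreeAlgebra.lift_ι_apply, genOp_idem]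
  simp [zeroFamily]

theorem stendhalRep_ev_right (a : Event k) (r : NilHecke 𝕜 ℓ k) :
    stendhalRep 𝕜 ℓ k (TAlg.ev 𝕜 (a.right ℓ)) (zeroFamily 𝕜 r) =
      zeroFamily 𝕜 (RingQuot.mkAlgHom 𝕜 _ (FreeAlgebra.ι 𝕜 a) * r) := by
  apply Subtype.ext
  rw [TAlg.ev, val_stendhalRep_mk, FreeAlgebra.lift_ι_apply]
  cases a with
  | dot p hp =>
    simp only [zeroFamily, Event.right, genOp_dot_single]
    rw [dotCoef_black (col_zero_right ℓ k p), Slice.nblack_zero_slice, NilHecke.Y, dif_pos hp]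
  | cross p hp =>
    simp only [zeroFamily, Event.right, genOp_cross_single]
    rw [crossCoef_black_black (col_zero_right ℓ k p) (col_zero_right ℓ k (p + 1)),
      Slice.nblack_zero_slice, NilHecke.X, dif_pos hp, Slice.swap_eq_self _ _
        ((col_zero_right ℓ k p).trans (col_zero_right ℓ k (p + 1)).symm)]

/-- The component at `Slice.zero` is the left regular representation of R, which is faithful. -/
theorem stendhalRep_cornerHom (a r : NilHecke 𝕜 ℓ k) :
    stendhalRep 𝕜 ℓ k (cornerHom 𝕜 ℓ k a).1 (zeroFamily 𝕜 r) = zeroFamily 𝕜 (a * r) := by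
  obtain ⟨a, rfl⟩ := RingQuot.mkAlgHom_surjective 𝕜 (NilHeckeRel 𝕜 ℓ k) a
  induction a generalizing r with
  | grade0 c =>
    rw [AlgHom.commutes, AlgHom.commutes, ← Algebra.smul_def]
    change stendhalRep 𝕜 ℓ k (c • eZero 𝕜 ℓ k) (zeroFamily 𝕜 r) = _
    rw [map_smul, LinearMap.smul_apply, stendhalRep_eZero]
    exact Subtype.ext (Pi.single_smul' _ c r).symm
  | grade1 a =>
    rw [cornerHom_mk, FreeAlgebra.lift_ι_apply, val_cornerEvent, map_mul, Module.End.mul_apply,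
      stendhalRep_eZero, stendhalRep_ev_right]
  | mul a b iha ihb =>
    rw [map_mul, map_mul (cornerHom 𝕜 ℓ k), mul_assoc]
    change stendhalRep 𝕜 ℓ k ((cornerHom 𝕜 ℓ k _).1 * (cornerHom 𝕜 ℓ k _).1) _ = _
    rw [map_mul, Module.End.mul_apply, ihb, iha]
  | add a b iha ihb =>
    rw [map_add, map_add, add_mul]
    change stendhalRep 𝕜 ℓ k ((cornerHom 𝕜 ℓ k _).1 + (cornerHom 𝕜 ℓ k _).1) _ = _
    rw [map_add, LinearMap.add_apply, iha, ihb]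
    exact Subtype.ext (Pi.single_add _ _ _).symm

theorem cornerHom_injective : Function.Injective (cornerHom 𝕜 ℓ k) := by
  intro a b h
  have ha := stendhalRep_cornerHom 𝕜 a 1
  rw [h, stendhalRep_cornerHom, mul_one, mul_one] at ha
  exact (Pi.single_injective _ (congrArg Subtype.val ha)).symm

end Representation

end Stendhal

theorem mainTheorem8 (𝕜 : Type*) [Field 𝕜] (ℓ k : ℕ) (hℓ : 0 < ℓ) :
    ∃ Φ : Stendhal.NilHecke 𝕜 ℓ k →ₙₐ[𝕜] Stendhal.TAlg 𝕜 ℓ k,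
      (∀ D : List (Stendhal.Event k),
        Φ (Stendhal.NilHecke.diagram 𝕜 ℓ k D) =
          Stendhal.TAlg.diagram 𝕜 (D.map (Stendhal.Event.right ℓ)) (Stendhal.Slice.zero ℓ k)) ∧
      ∃ Ψ : Stendhal.NilHecke 𝕜 ℓ k ≃ₐ[𝕜] (Stendhal.isIdempotentElem_eZero 𝕜 ℓ k).Corner,
        ∀ a, (Ψ a).1 = Φ a := by
  refine ⟨
    { toFun := fun a => (Stendhal.cornerHom 𝕜 ℓ k a).1
      map_smul' := fun c a => by rw [map_smul]; rfl
      map_zero' := by rw [map_zero]; rfl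
      map_add' := fun a b => by rw [map_add]; rfl
      map_mul' := fun a b => by rw [map_mul]; rfl },
    Stendhal.val_cornerHom_diagram 𝕜 ℓ k,
    AlgEquiv.ofBijective (Stendhal.cornerHom 𝕜 ℓ k)
      ⟨Stendhal.cornerHom_injective 𝕜, Stendhal.cornerHom_surjective 𝕜⟩, fun _ => rfl⟩
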